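/- For a finite lattice $L$ let $\operatorname{Con} L$ be its lattice of congruences, ordered by inclusion, with least element $\mathbf 0$ and greatest element $\mathbf 1$, and for $a,b\in L$ let $\operatorname{con}(a,b)$ be the smallest congruence of $L$ that identifies $a$ and $b$; the congruences of this form are called principal. A minimal representation of a finite distributive lattice $D$ is a finite (nonempty) lattice $L$ such that $\operatorname{Con} L\cong D$ and the set of principal congruences of $L$ is exactly $\{\mathbf 0,\mathbf 1\}\cup\{\alpha\in\operatorname{Con} L : \alpha \text{ is join-irreducible}\}$. **Theorem.** Let $D$ be a finite (nonempty) distributive lattice. Then $D$ has a minimal representation if and only if $D$ has at most two dual atoms. Equivalently, $D$ has a minimal representation when it has no dual atom (that is, when it has one element), exactly one, or exactly two dual atoms, and has none when it has three or more dual atoms. -/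

import Mathlib

universe u

namespace LatticeCon

variable {α : Type u} [Lattice α]

/-- A lattice congruence is determined by its underlying relation. -/
theorem ext_rel {c d : LatticeCon α} (h : ∀ x y, c.r x y ↔ d.r x y) : c = d := by
  cases c
  cases d
  congr 1
  exact Setoid.ext h

/-- Congruences are ordered by inclusion: `c ≤ d` means that `x ≡ y (mod c)` implies
`x ≡ y (mod d)`. -/
instance instPartialOrder : PartialOrder (LatticeCon α) where
  le c d := ∀ x y, c.r x y → d.r x y
  le_refl _ _ _ h := h
  le_trans _ _ _ h₁ h₂ x y h := h₂ x y (h₁ x y h)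
  le_antisymm _ _ h₁ h₂ := ext_rel fun x y => ⟨h₁ x y, h₂ x y⟩

/-- The intersection of a set of congruences. -/
instance instInfSet : InfSet (LatticeCon α) where
  sInf S :=
    { r := fun x y => ∀ c ∈ S, c.r x y
      iseqv :=
        { refl := fun x d _ => d.iseqv.refl x
          symm := fun h c hc => c.iseqv.symm (h c hc)
          trans := fun h₁ h₂ c hc => c.iseqv.trans (h₁ c hc) (h₂ c hc) }
      inf := fun h₁ h₂ c hc => c.inf (h₁ c hc) (h₂ c hc)
      sup := fun h₁ h₂ c hc => c.sup (h₁ c hc) (h₂ c hc) }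

theorem isGLB_sInf' (S : Set (LatticeCon α)) : IsGLB S (sInf S) :=
  ⟨fun _ hc _ _ h => h _ hc, fun _ hd x y h _ hc => hd hc x y h⟩

/-- `Con α`, the lattice of all congruences of the lattice `α`, ordered by inclusion.
Its least element `⊥` is equality, its greatest element `⊤` is the all relation. -/
instance instCompleteLattice : CompleteLattice (LatticeCon α) :=
  { completeLatticeOfInf (LatticeCon α) isGLB_sInf' with
    bot :=
      { r := fun x y => x = y
        iseqv := ⟨fun _ => rfl, fun h => h.symm, fun h₁ h₂ => h₁.trans h₂⟩
        inf := fun h₁ h₂ => by rw [h₁, h₂]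
        sup := fun h₁ h₂ => by rw [h₁, h₂] }
    bot_le := fun c x y h => h ▸ c.iseqv.refl x
    top :=
      { r := fun _ _ => True
        iseqv := ⟨fun _ => trivial, fun _ => trivial, fun _ _ => trivial⟩
        inf := fun _ _ => trivial
        sup := fun _ _ => trivial }
    le_top := fun _ _ _ _ => trivial }

/-- The congruence `con(a, b)` generated by the pair `a, b`: the smallest congruence `c` with
`a ≡ b (mod c)`. -/
def principal (a b : α) : LatticeCon α :=
  sInf {c | c.r a b}

end LatticeCon

/-- `Princ L`, the set of principal congruences of the lattice `L`. -/
def princSet (L : Type u) [Lattice L] : Set (LatticeCon L) :=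
  {c | ∃ a b : L, c = LatticeCon.principal a b}

/-- `Min L`, consisting of the congruences `0`, `1` and the join-irreducible congruences of `L`. -/
def minSet (L : Type u) [Lattice L] : Set (LatticeCon L) :=
  {⊥, ⊤} ∪ {c | SupIrred c}

/-- The lattice `L` is a minimal representation of the lattice `D`: the congruence lattice of `L`
is isomorphic to `D`, and `Princ L = Min L`. (An order isomorphism between lattices is the same
as a lattice isomorphism.) -/
def IsMinimalRepresentation (D L : Type u) [Lattice D] [Lattice L] : Prop :=
  Nonempty (D ≃o LatticeCon L) ∧ princSet L = minSet L

/-- `D` has a minimal representation by a finite (nonempty) lattice. -/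
def HasMinimalRepresentation (D : Type u) [Lattice D] : Prop :=
  ∃ (L : Type u) (_ : Lattice L) (_ : Finite L) (_ : Nonempty L), IsMinimalRepresentation D L

/-!
Minimal representations of a finite distributive lattice.

Necessity. Let `L` be a finite lattice whose principal congruences are `⊥`, `⊤` and the
join-irreducible ones, and let `[a, b]` be an interval with `con(a, b) = ⊤` that cannot be shrunk from
either end. If it contains an element `c` strictly between its ends, then `⊤` is the join of
`con(a, c)` and `con(c, b)`, each of which is join-irreducible or `⊥`; a join-irreducible element of a
distributive lattice lies below all dual atoms with at most one exception, so there are at most two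
dual atoms. If `b` covers `a`, then two dual atoms `α ≠ β` would have the join `⊤`, so `α` or `β`
would identify `a` and `b` (`LatticeCon.r_or_r_of_covBy`); so there is at most one dual atom. This is
`ncard_coatoms_le_two`.

Sufficiency. By `isMinimalRepresentation_of_colouring` it is enough to build a finite lattice in which
every nontrivial interval generates the congruence of one colour, a join-irreducible element of `D`,
or the unit congruence, and in which the sets of colours that congruences collapse are exactly the
down-sets.

If the unit `m` of `D` is join-irreducible, this is the frame lattice `Frame Q` of the poset `Q` of
join-irreducible elements below `m`. Its elements are a top and the `{0, 1, 2}`-valued functions whose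
support is a chain of `Q`, or one of three extra points, and that are antitone on the support, with
the value `2` not allowed at the extra points. Collapsing two elements with different supports
collapses some atom with the bottom, and then the extra points, being complements of everything else,
force the whole lattice to collapse (`Frame.r_iff_of_supp_ne`). Two comparable elements with the same
support differ on a chain, and collapsing them amounts to collapsing the values `1` and `2` at the
largest point of it (`Frame.exists_colour`). Antitonicity is what makes a point force the points below
it (`Frame.lo_hi_mono`).

If the unit is the join of two maximal join-irreducible elements `m₁`, `m₂`, put `Frame Q₂` on top of
the dual of `Frame Q₁`, where `Qᵢ` consists of the join-irreducible elements below `mᵢ`. An interval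
that meets both parts properly has the colour `m₁ ∨ m₂ = ⊤`, as it should. It remains to identify the
two copies of a colour `c` that lies below both `m₁` and `m₂`. The two intervals of colour `c` span a
prime square in the product of the two lattices. Below the upper end `hi c` of such an interval, a frame
lattice has only the three elements `⊥`, `lo c`, `hi c`, and since the first factor is taken dually, in
both factors this is the side on which the two parts meet. Hence adding the squares to the two parts
gives a sublattice of the product (`glue`), and it creates no bad intervals.
Inserting into each square an element that makes it a diamond `M₃` (`Inserted`) identifies its two
colours (`glue.lower_lo_hi_iff`) and creates no interval with a new kind of congruence
(`Inserted.r_new_old_iff`, `Inserted.r_old_new_iff`).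
-/

/-! ### Generalities on lattice congruences -/

namespace LatticeCon

variable {α : Type u} [Lattice α]

theorem r_self (c : LatticeCon α) (x : α) : c.r x x := c.iseqv.refl x

theorem inf_left (c : LatticeCon α) {x y : α} (z : α) (h : c.r x y) : c.r (z ⊓ x) (z ⊓ y) :=
  c.inf (c.r_self z) h

theorem sup_left (c : LatticeCon α) {x y : α} (z : α) (h : c.r x y) : c.r (z ⊔ x) (z ⊔ y) :=
  c.sup (c.r_self z) h

theorem principal_le_iff {a b : α} {c : LatticeCon α} : principal a b ≤ c ↔ c.r a b :=
  ⟨fun h => h a b fun _ hd => hd, fun h => sInf_le h⟩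

theorem principal_inf_sup (a b : α) : principal (a ⊓ b) (a ⊔ b) = principal a b :=
  eq_of_forall_ge_iff fun c => by rw [principal_le_iff, principal_le_iff, r_inf_sup_iff]

theorem ext_lt {c d : LatticeCon α} (h : ∀ x y, x < y → (c.r x y ↔ d.r x y)) : c = d := by
  refine ext_rel fun x y => ?_
  rw [← c.r_inf_sup_iff, ← d.r_inf_sup_iff]
  rcases (inf_le_sup (a := x) (b := y)).eq_or_lt with he | hlt
  · rw [he]
    exact ⟨fun _ => d.r_self _, fun _ => c.r_self _⟩
  · exact h _ _ hlt

/-- A congruence collapses an interval as soon as it identifies the endpoints. -/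
theorem r_of_mem_interval (c : LatticeCon α) {a b x y : α} (h : c.r a b) (hax : a ≤ x) (hxb : x ≤ b)
    (hay : a ≤ y) (hyb : y ≤ b) : c.r x y := by
  have key : ∀ z, a ≤ z → z ≤ b → c.r a z := fun z h1 h2 => by
    have := c.inf_left z h
    rwa [inf_eq_right.2 h1, inf_eq_left.2 h2] at this
  exact c.iseqv.trans (c.iseqv.symm (key x hax hxb)) (key y hay hyb)

/-- The pullback of a congruence along a lattice homomorphism. -/
def comap {β : Type*} [Lattice β] (f : LatticeHom β α) (c : LatticeCon α) : LatticeCon β where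
  r x y := c.r (f x) (f y)
  iseqv := ⟨fun _ => c.iseqv.refl _, fun h => c.iseqv.symm h, fun h h' => c.iseqv.trans h h'⟩
  inf h h' := by
    rw [map_inf, map_inf]
    exact c.inf h h'
  sup h h' := by
    rw [map_sup, map_sup]
    exact c.sup h h'

/-- A congruence of the order dual of `α`, seen as a congruence of `α`. -/
def ofDual (c : LatticeCon αᵒᵈ) : LatticeCon α where
  r x y := c.r (OrderDual.toDual x) (OrderDual.toDual y)
  iseqv := ⟨fun _ => c.iseqv.refl _, fun h => c.iseqv.symm h, fun h h' => c.iseqv.trans h h'⟩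
  inf h h' := c.sup h h'
  sup h h' := c.inf h h'

/-- The transitive closure of the union of two congruences. It bounds their join from above. -/
def transUnion (c d : LatticeCon α) : LatticeCon α where
  r := Relation.ReflTransGen fun x y => c.r x y ∨ d.r x y
  iseqv :=
    { refl := fun _ => .refl
      symm := fun h => by
        induction h with
        | refl => exact .refl
        | tail _ h ih => exact .head (h.imp c.iseqv.symm d.iseqv.symm) ih
      trans := fun h h' => h.trans h' }
  inf {_ x y _} h h' :=
    (h.lift (· ⊓ y) fun _ _ h => h.imp (fun h => c.inf h (c.r_self _))
      (fun h => d.inf h (d.r_self _))).trans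
    (h'.lift (x ⊓ ·) fun _ _ h => h.imp (c.inf_left _) (d.inf_left _))
  sup {_ x y _} h h' :=
    (h.lift (· ⊔ y) fun _ _ h => h.imp (fun h => c.sup h (c.r_self _))
      (fun h => d.sup h (d.r_self _))).trans
    (h'.lift (x ⊔ ·) fun _ _ h => h.imp (c.sup_left _) (d.sup_left _))

/-- A covering pair identified by the join of two congruences is identified by one of them:
retracting a connecting chain onto the two-element interval turns one of its links into the
covering pair. -/
theorem r_or_r_of_covBy {c d : LatticeCon α} {a b : α} (hab : a ⋖ b) (h : (c ⊔ d).r a b) :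
    c.r a b ∨ d.r a b := by
  have hle : c ⊔ d ≤ transUnion c d :=
    sup_le (fun _ _ h => .single (.inl h)) (fun _ _ h => .single (.inr h))
  have h : Relation.ReflTransGen (fun x y => c.r x y ∨ d.r x y) a b := hle _ _ h
  have key : ∀ x, Relation.ReflTransGen (fun x y => c.r x y ∨ d.r x y) a x →
      (c.r a b ∨ d.r a b) ∨ b ⊓ (a ⊔ x) = a := by
    intro x hx
    induction hx with
    | refl => exact .inr (by simp [hab.le])
    | @tail y z _ hyz ih =>
      rcases ih with ih | ih
      · exact .inl ih
      rcases hab.eq_or_eq (c := b ⊓ (a ⊔ z)) (le_inf hab.le le_sup_left) inf_le_left with hz | hz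
      · exact .inr hz
      · rw [← hz, ← ih]
        simp only [ih]
        refine .inl (hyz.imp (fun h => ?_) (fun h => ?_))
        · have := c.inf_left b (c.sup_left a h)
          rwa [ih] at this
        · have := d.inf_left b (d.sup_left a h)
          rwa [ih] at this
  rcases key b h with h | h
  · exact h
  · rw [sup_eq_right.2 hab.le, inf_idem] at h
    exact absurd h hab.ne'
end LatticeCon

/-! ### Necessity: at most two dual atoms -/

section Necessity

variable {D L : Type u} [DistribLattice D] [Lattice L]

theorem IsCoatom.eq_of_not_le_of_supIrred {a c₁ c₂ : D} [OrderTop D] (h₁ : IsCoatom c₁)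
    (h₂ : IsCoatom c₂) (ha : SupIrred a) (ha₁ : ¬ a ≤ c₁) (ha₂ : ¬ a ≤ c₂) : c₁ = c₂ := by
  by_contra hne
  rcases (supPrime_iff_supIrred.2 ha).le_sup.1
    (h₁.sup_eq_top_of_ne h₂ hne ▸ le_top) with h | h
  exacts [ha₁ h, ha₂ h]

theorem OrderIso.supIrred_apply {α β : Type*} [SemilatticeSup α] [SemilatticeSup β] (e : α ≃o β)
    {a : α} (ha : SupIrred a) : SupIrred (e a) := by
  refine ⟨fun h => ha.1 fun b hb => ?_, fun b c h => ?_⟩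
  · exact e.le_iff_le.1 (h (e.le_iff_le.2 hb))
  · have h' : e.symm b ⊔ e.symm c = a := by rw [← map_sup, h, e.symm_apply_apply]
    rcases ha.2 h' with h | h
    · exact .inl (by rw [← h, e.apply_symm_apply])
    · exact .inr (by rw [← h, e.apply_symm_apply])

/-- If `1 = con(a, b)` in a finite lattice, then shrinking the interval `[a, b]` as far as possible
leaves a covering pair, or an interval that splits `1` into two smaller principal congruences. -/
theorem LatticeCon.exists_covBy_or_split [Finite L] (h : ⊤ ∈ princSet L)
    (hL : (⊤ : LatticeCon L) ≠ ⊥) :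
    (∃ a b : L, a ⋖ b ∧ principal a b = ⊤) ∨
      ∃ α ∈ princSet L, ∃ β ∈ princSet L, α ≠ ⊤ ∧ β ≠ ⊤ ∧ α ⊔ β = ⊤ := by
  obtain ⟨a₀, b₀, h₀⟩ := h
  obtain ⟨b, ⟨a₁, ha₁, hb⟩, hbmin⟩ := (Set.toFinite {b : L | ∃ a ≤ b, principal a b = ⊤}).exists_minimal
    ⟨a₀ ⊔ b₀, a₀ ⊓ b₀, inf_le_sup, by rw [principal_inf_sup, h₀]⟩
  obtain ⟨a, ⟨hab, ha⟩, hamax⟩ := (Set.toFinite {a : L | a ≤ b ∧ principal a b = ⊤}).exists_maximal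
    ⟨a₁, ha₁, hb⟩
  have hne : a ≠ b := by
    rintro rfl
    exact hL (le_bot_iff.1 (ha ▸ principal_le_iff.2 (r_self _ a)))
  by_cases hcov : a ⋖ b
  · exact .inl ⟨a, b, hcov, ha⟩
  rw [not_covBy_iff (hab.lt_of_ne hne)] at hcov
  obtain ⟨c, hac, hcb⟩ := hcov
  refine .inr ⟨principal a c, ⟨a, c, rfl⟩, principal c b, ⟨c, b, rfl⟩, fun h => ?_, fun h => ?_, ?_⟩
  · exact hcb.not_ge (hbmin ⟨a, hac.le, h⟩ hcb.le)
  · exact hac.not_ge (hamax ⟨hcb.le, h⟩ hac.le)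
  · rw [eq_top_iff, ← ha, principal_le_iff]
    refine Setoid.trans' _ (y := c) ?_ ?_
    · exact principal_le_iff.1 le_sup_left
    · exact principal_le_iff.1 le_sup_right

theorem ncard_coatoms_le_two [BoundedOrder D] [Finite L]
    (h : IsMinimalRepresentation D L) : {a : D | IsCoatom a}.ncard ≤ 2 := by
  obtain ⟨⟨e⟩, hmin⟩ := h
  by_contra hcard
  obtain ⟨c₁, c₂, c₃, h₁, h₂, h₃, h₁₂, h₁₃, h₂₃⟩ := Set.two_lt_ncard_iff
    (Set.finite_of_ncard_pos (by omega)) |>.1 (not_le.1 hcard)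
  have htop : e ⊤ = ⊤ := map_top e
  have hbot : (⊤ : LatticeCon L) ≠ ⊥ := fun h => by
    have : (⊤ : D) = ⊥ := e.injective (by rw [map_top, map_bot, h])
    exact h₁.1 (le_antisymm le_top (this ▸ bot_le))
  have htop_mem : ⊤ ∈ princSet L := hmin ▸ .inl (.inr rfl)
  rcases LatticeCon.exists_covBy_or_split htop_mem hbot with ⟨a, b, hab, hT⟩ | ⟨α, hα, β, hβ, hα1, hβ1, hsup⟩
  · have hc : e c₁ ⊔ e c₂ = ⊤ := by
      rw [← map_sup, IsCoatom.sup_eq_top_of_ne h₁ h₂ h₁₂, htop]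
    have key : ∀ {c : D}, IsCoatom c → ¬ (e c).r a b := fun {c} hc h => by
      rw [← LatticeCon.principal_le_iff, hT, top_le_iff, ← htop] at h
      exact hc.1 (e.injective h)
    rcases LatticeCon.r_or_r_of_covBy (c := e c₁) (d := e c₂) hab (by rw [hc]; trivial) with h | h
    exacts [key h₁ h, key h₂ h]
  · have key : ∀ γ ∈ princSet L, γ ≠ ⊤ → ∀ {c d : D}, IsCoatom c → IsCoatom d → c ≠ d →
        e.symm γ ≤ c ∨ e.symm γ ≤ d := by
      intro γ hγ hγ1 c d hc hd hcd
      rw [hmin] at hγ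
      rcases hγ with (rfl | rfl) | hγ
      · left
        rw [map_bot]
        exact bot_le
      · exact absurd rfl hγ1
      · by_contra hcon
        push Not at hcon
        exact hcd (hc.eq_of_not_le_of_supIrred hd (e.symm.supIrred_apply hγ) hcon.1 hcon.2)
    have hsup' : e.symm α ⊔ e.symm β = ⊤ := by rw [← map_sup, hsup, map_top]
    have hor : ∀ {c : D}, IsCoatom c → e.symm α ≤ c → e.symm β ≤ c → False := fun hc h h' =>
      hc.1 (top_le_iff.1 (hsup' ▸ sup_le h h'))
    have A := fun {c d : D} => key α hα hα1 (c := c) (d := d)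
    have B := fun {c d : D} => key β hβ hβ1 (c := c) (d := d)
    have := A h₁ h₂ h₁₂
    have := A h₁ h₃ h₁₃
    have := A h₂ h₃ h₂₃
    have := B h₁ h₂ h₁₂
    have := B h₁ h₃ h₁₃
    have := B h₂ h₃ h₂₃
    have := hor h₁
    have := hor h₂
    have := hor h₃
    grind

end Necessity

/-! ### Congruence lattices from a colouring of the intervals -/

section Criterion

variable {D L : Type u} [DistribLattice D] [BoundedOrder D] [Finite D] [Lattice L]

theorem le_iff_forall_supIrred_le {a b : D} : a ≤ b ↔ ∀ p, SupIrred p → p ≤ a → p ≤ b := by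
  refine ⟨fun h p _ hp => hp.trans h, fun h => ?_⟩
  obtain ⟨s, rfl, hs⟩ := exists_supIrred_decomposition a
  exact Finset.sup_le fun p hp => h p (hs hp) (Finset.le_sup (f := id) hp)

/-- A finite lattice `L` is a minimal representation of `D` if its intervals can be coloured by the
join-irreducible elements of `D`, with one further colour for the unit. `Col φ p` says that the
congruence `φ` collapses the colour `p`; an interval of colour `p` is identified by exactly those
`φ` that collapse `p`, an interval of the extra colour by those that collapse everything.
By `hmono` the collapsed colours form a down-set, and by `hθ` every down-set arises. -/
theorem isMinimalRepresentation_of_colouring [BoundedOrder L] (θ : D → LatticeCon L)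
    (Col : LatticeCon L → D → Prop)
    (hpair : ∀ p, SupIrred p → ∃ a b, ∀ φ : LatticeCon L, φ.r a b ↔ Col φ p)
    (hθ : ∀ d p, SupIrred p → (Col (θ d) p ↔ p ≤ d))
    (hmono : ∀ φ p q, SupIrred p → SupIrred q → q ≤ p → Col φ p → Col φ q)
    (hlt : ∀ x y : L, x < y → (∃ p, SupIrred p ∧ ∀ φ : LatticeCon L, φ.r x y ↔ Col φ p) ∨
      ∀ φ : LatticeCon L, φ.r x y ↔ ∀ p, SupIrred p → Col φ p) :
    IsMinimalRepresentation D L := by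
  have hext : ∀ φ ψ : LatticeCon L, (∀ p, SupIrred p → (Col φ p ↔ Col ψ p)) → φ = ψ := by
    refine fun φ ψ h => LatticeCon.ext_lt fun x y hxy => ?_
    rcases hlt x y hxy with ⟨p, hp, h'⟩ | h'
    · rw [h', h', h p hp]
    · rw [h', h']
      exact forall₂_congr h
  have hsurj : Function.Surjective θ := by
    intro φ
    classical
    let s : Finset D := (Set.toFinite {p | SupIrred p ∧ Col φ p}).toFinset
    have hs : ∀ p, p ∈ s ↔ SupIrred p ∧ Col φ p := fun p => by simp [s]
    refine ⟨s.sup id, hext _ _ fun p hp => (hθ _ p hp).trans ⟨fun h => ?_, fun h => ?_⟩⟩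
    · obtain ⟨q, hq, hpq⟩ := (supPrime_iff_supIrred.2 hp).le_finset_sup.1 h
      exact hmono φ q p ((hs q).1 hq).1 hp hpq ((hs q).1 hq).2
    · exact Finset.le_sup (f := id) ((hs p).2 ⟨hp, h⟩)
  have hle : ∀ {d d' : D}, θ d ≤ θ d' ↔ d ≤ d' := by
    refine fun {d d'} => ⟨fun h => le_iff_forall_supIrred_le.2 fun p hp hpd => ?_, fun h x y hxy => ?_⟩
    · obtain ⟨a, b, hab⟩ := hpair p hp
      rw [← hθ _ _ hp, ← hab] at hpd ⊢
      exact h _ _ hpd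
    · have hcol : ∀ p, SupIrred p → Col (θ d) p → Col (θ d') p := fun p hp hc =>
        (hθ _ p hp).2 (((hθ _ p hp).1 hc).trans h)
      rw [← LatticeCon.r_inf_sup_iff] at hxy ⊢
      rcases (inf_le_sup (a := x) (b := y)).eq_or_lt with he | hl
      · rw [he]
      · rcases hlt _ _ hl with ⟨p, hp, h'⟩ | h'
        · exact (h' _).2 (hcol p hp ((h' _).1 hxy))
        · exact (h' _).2 fun p hp => hcol p hp ((h' _).1 hxy p hp)
  let e : D ≃o LatticeCon L :=
    RelIso.ofSurjective (OrderEmbedding.ofMapLEIff θ fun _ _ => hle) hsurj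
  have he : ∀ d, e d = θ d := fun _ => rfl
  have hprinc : ∀ {a b : L} {p : D}, SupIrred p → (∀ φ : LatticeCon L, φ.r a b ↔ Col φ p) →
      LatticeCon.principal a b = e p := by
    refine fun {a b p} hp h => eq_of_forall_ge_iff fun φ => ?_
    obtain ⟨d, rfl⟩ := hsurj φ
    rw [LatticeCon.principal_le_iff, h, hθ _ _ hp, he, hle]
  refine ⟨⟨e⟩, Set.ext fun c => ⟨?_, ?_⟩⟩
  · rintro ⟨x, y, rfl⟩
    rw [← LatticeCon.principal_inf_sup]
    rcases (inf_le_sup (a := x) (b := y)).eq_or_lt with heq | hl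
    · rw [heq]
      exact .inl (.inl (le_bot_iff.1 (LatticeCon.principal_le_iff.2 (LatticeCon.r_self _ _))))
    · rcases hlt _ _ hl with ⟨p, hp, h'⟩ | h'
      · rw [hprinc hp h']
        exact .inr (e.supIrred_apply hp)
      · refine .inl (.inr (eq_top_iff.2 ?_))
        rw [← hext (LatticeCon.principal _ _) ⊤ fun p hp => ?_]
        exact iff_of_true ((h' _).1 (LatticeCon.principal_le_iff.1 le_rfl) p hp)
          ((h' ⊤).1 trivial p hp)
  · rintro ((rfl | rfl) | hc)
    · exact ⟨⊥, ⊥, (le_bot_iff.1 (LatticeCon.principal_le_iff.2 (LatticeCon.r_self _ _))).symm⟩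
    · refine ⟨⊥, ⊤, (eq_top_iff.2 fun x y _ => ?_).symm⟩
      exact LatticeCon.r_of_mem_interval _ (LatticeCon.principal_le_iff.1 le_rfl) bot_le le_top
        bot_le le_top
    · obtain ⟨p, rfl⟩ := e.surjective c
      have hp : SupIrred p := by simpa using e.symm.supIrred_apply hc
      obtain ⟨a, b, hab⟩ := hpair p hp
      exact ⟨a, b, (hprinc hp hab).symm⟩

end Criterion

/-! ### The frame lattice of a poset -/

/-- Comparability on the index set `Q ⊕ Fin 3` of the frame lattice: comparability inside `Q`, and
three extra points that are comparable only with themselves. -/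
def FrameComparable {Q : Type u} [PartialOrder Q] : Q ⊕ Fin 3 → Q ⊕ Fin 3 → Prop
  | .inl p, .inl q => p ≤ q ∨ q ≤ p
  | .inr i, .inr j => i = j
  | _, _ => False

/-- A set of indices that are pairwise comparable. -/
def IsFrameChain {Q : Type u} [PartialOrder Q] (s : Set (Q ⊕ Fin 3)) : Prop :=
  ∀ j ∈ s, ∀ k ∈ s, FrameComparable j k

theorem IsFrameChain.mono {Q : Type u} [PartialOrder Q] {s t : Set (Q ⊕ Fin 3)}
    (ht : IsFrameChain t) (h : s ⊆ t) : IsFrameChain s :=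
  fun j hj k hk => ht j (h hj) k (h hk)

/-- The frame lattice of a poset `Q`. Besides a top element it consists of the functions
`Q ⊕ Fin 3 → {0, 1, 2}` whose support is a chain of comparable indices, that take the value `2` only
in `Q`, and whose value on the part of the support inside `Q` is antitone. Such a function is encoded
by its support `supp` and by the set `full` of the points of value `2`; the top element is encoded by
`supp = univ`, `full = univ`. -/
@[ext] structure Frame (Q : Type u) [PartialOrder Q] where
  supp : Set (Q ⊕ Fin 3)
  full : Set Q
  full_sub : ∀ p ∈ full, .inl p ∈ supp
  lower : ∀ p q, q ∈ full → p ≤ q → .inl p ∈ supp → p ∈ full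
  chain : IsFrameChain supp ∨ supp = Set.univ ∧ full = Set.univ

namespace Frame

variable {Q : Type u} [PartialOrder Q]

instance : PartialOrder (Frame Q) where
  le X Y := X.supp ⊆ Y.supp ∧ X.full ⊆ Y.full
  le_refl _ := ⟨subset_rfl, subset_rfl⟩
  le_trans _ _ _ h h' := ⟨h.1.trans h'.1, h.2.trans h'.2⟩
  le_antisymm _ _ h h' := Frame.ext (h.1.antisymm h'.1) (h.2.antisymm h'.2)

/-- Meets are computed pointwise. For joins, if the union of the supports is not a chain, then the
implications in the definition hold for all indices and the join is the top element. -/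
instance : Lattice (Frame Q) where
  inf X Y :=
    { supp := X.supp ∩ Y.supp
      full := X.full ∩ Y.full
      full_sub := fun p hp => ⟨X.full_sub p hp.1, Y.full_sub p hp.2⟩
      lower := fun p q hq hpq hp => ⟨X.lower p q hq.1 hpq hp.1, Y.lower p q hq.2 hpq hp.2⟩
      chain := by
        rcases X.chain with h | ⟨h, h'⟩
        · exact .inl (h.mono Set.inter_subset_left)
        rcases Y.chain with k | ⟨k, k'⟩
        · exact .inl (k.mono Set.inter_subset_right)
        · exact .inr ⟨by rw [h, k, Set.inter_self], by rw [h', k', Set.inter_self]⟩ }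
  sup X Y :=
    { supp := {j | IsFrameChain (X.supp ∪ Y.supp) → j ∈ X.supp ∪ Y.supp}
      full := {p | IsFrameChain (X.supp ∪ Y.supp) →
        .inl p ∈ X.supp ∪ Y.supp ∧ ∃ q ∈ X.full ∪ Y.full, p ≤ q}
      full_sub := fun p hp h => (hp h).1
      lower := fun p q hq hpq hp h =>
        ⟨hp h, let ⟨r, hr, hqr⟩ := (hq h).2; ⟨r, hr, hpq.trans hqr⟩⟩
      chain := by
        by_cases h : IsFrameChain (X.supp ∪ Y.supp)
        · exact .inl (h.mono fun j hj => hj h)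
        · exact .inr ⟨Set.eq_univ_of_forall fun j h' => absurd h' h,
            Set.eq_univ_of_forall fun j h' => absurd h' h⟩ }
  inf_le_left _ _ := ⟨Set.inter_subset_left, Set.inter_subset_left⟩
  inf_le_right _ _ := ⟨Set.inter_subset_right, Set.inter_subset_right⟩
  le_inf _ _ _ h h' := ⟨Set.subset_inter h.1 h'.1, Set.subset_inter h.2 h'.2⟩
  le_sup_left X _ := ⟨fun _ hj _ => .inl hj,
    fun p hp _ => ⟨.inl (X.full_sub p hp), p, .inl hp, le_rfl⟩⟩
  le_sup_right _ Y := ⟨fun _ hj _ => .inr hj,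
    fun p hp _ => ⟨.inr (Y.full_sub p hp), p, .inr hp, le_rfl⟩⟩
  sup_le X Y Z h h' := by
    have hs := Set.union_subset h.1 h'.1
    rcases Z.chain with hZ | ⟨hZ, hZ'⟩
    · refine ⟨fun j hj => hs (hj (hZ.mono hs)), fun p hp => ?_⟩
      obtain ⟨hp, q, hq, hpq⟩ := hp (hZ.mono hs)
      exact Z.lower p q (Set.union_subset h.2 h'.2 hq) hpq (hs hp)
    · exact ⟨fun _ _ => hZ.ge trivial, fun _ _ => hZ'.ge trivial⟩

instance : BoundedOrder (Frame Q) where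
  bot :=
    { supp := ∅
      full := ∅
      full_sub := fun _ h => h.elim
      lower := fun _ _ h => h.elim
      chain := .inl fun _ h => h.elim }
  bot_le _ := ⟨Set.empty_subset _, Set.empty_subset _⟩
  top :=
    { supp := Set.univ
      full := Set.univ
      full_sub := fun _ _ => trivial
      lower := fun _ _ _ _ _ => trivial
      chain := .inr ⟨rfl, rfl⟩ }
  le_top _ := ⟨Set.subset_univ _, Set.subset_univ _⟩

instance [Finite Q] : Finite (Frame Q) :=
  Finite.of_injective (fun X : Frame Q => (X.supp, X.full)) fun _ _ h =>
    Frame.ext (congrArg Prod.fst h) (congrArg Prod.snd h)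

theorem le_def {X Y : Frame Q} : X ≤ Y ↔ X.supp ⊆ Y.supp ∧ X.full ⊆ Y.full := Iff.rfl

@[simp] theorem supp_inf (X Y : Frame Q) : (X ⊓ Y).supp = X.supp ∩ Y.supp := rfl

@[simp] theorem full_inf (X Y : Frame Q) : (X ⊓ Y).full = X.full ∩ Y.full := rfl

@[simp] theorem supp_bot : (⊥ : Frame Q).supp = ∅ := rfl

@[simp] theorem full_bot : (⊥ : Frame Q).full = ∅ := rfl

@[simp] theorem supp_top : (⊤ : Frame Q).supp = Set.univ := rfl

theorem mem_supp_sup {X Y : Frame Q} {j : Q ⊕ Fin 3} :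
    j ∈ (X ⊔ Y).supp ↔ (IsFrameChain (X.supp ∪ Y.supp) → j ∈ X.supp ∪ Y.supp) := Iff.rfl

theorem mem_full_sup {X Y : Frame Q} {p : Q} : p ∈ (X ⊔ Y).full ↔
    (IsFrameChain (X.supp ∪ Y.supp) → .inl p ∈ X.supp ∪ Y.supp ∧ ∃ q ∈ X.full ∪ Y.full, p ≤ q) :=
  Iff.rfl

theorem sup_eq_top {X Y : Frame Q} {j k : Q ⊕ Fin 3} (hj : j ∈ X.supp) (hk : k ∈ Y.supp)
    (h : ¬ FrameComparable j k) : X ⊔ Y = ⊤ := by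
  have hc : ¬ IsFrameChain (X.supp ∪ Y.supp) := fun hc => h (hc j (.inl hj) k (.inr hk))
  exact Frame.ext (Set.eq_univ_of_forall fun j h => absurd h hc)
    (Set.eq_univ_of_forall fun j h => absurd h hc)

theorem frameComparable_self (j : Q ⊕ Fin 3) : FrameComparable j j := by
  cases j <;> simp [FrameComparable]

theorem isFrameChain_singleton (j : Q ⊕ Fin 3) : IsFrameChain {j} := by
  rintro _ rfl _ rfl
  exact frameComparable_self _

/-- The function with value `1` at `j` and `0` elsewhere. -/
def unit (j : Q ⊕ Fin 3) : Frame Q where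
  supp := {j}
  full := ∅
  full_sub _ h := h.elim
  lower _ _ h := h.elim
  chain := .inl (isFrameChain_singleton j)

/-- The lower end of the interval that carries the colour `p`: value `1` at `p`. -/
def lo (p : Q) : Frame Q := unit (.inl p)

/-- The upper end of the interval that carries the colour `p`: value `2` at `p`. -/
def hi (p : Q) : Frame Q where
  supp := {.inl p}
  full := {p}
  full_sub _ h := congrArg Sum.inl h
  lower _ _ _ _ h := Sum.inl_injective h
  chain := .inl (isFrameChain_singleton _)

@[simp] theorem supp_unit (j : Q ⊕ Fin 3) : (unit j).supp = {j} := rfl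

@[simp] theorem full_unit (j : Q ⊕ Fin 3) : (unit j).full = ∅ := rfl

@[simp] theorem supp_lo (p : Q) : (lo p).supp = {.inl p} := rfl

@[simp] theorem full_lo (p : Q) : (lo p).full = ∅ := rfl

@[simp] theorem supp_hi (p : Q) : (hi p).supp = {.inl p} := rfl

@[simp] theorem full_hi (p : Q) : (hi p).full = {p} := rfl

theorem lo_le_hi (p : Q) : lo p ≤ hi p := ⟨subset_rfl, Set.empty_subset _⟩

theorem lo_le_iff {p : Q} {X : Frame Q} : lo p ≤ X ↔ .inl p ∈ X.supp := by
  simp [le_def]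

theorem hi_le_iff {p : Q} {X : Frame Q} : hi p ≤ X ↔ p ∈ X.full := by
  simpa [le_def] using X.full_sub p

theorem not_hi_le_lo (p q : Q) : ¬ hi p ≤ lo q := by simp [hi_le_iff]

theorem hi_inf_hi_of_ne {p q : Q} (h : p ≠ q) : hi p ⊓ hi q = ⊥ := by
  ext j <;> simp only [supp_inf, full_inf, supp_hi, full_hi, supp_bot, full_bot] <;> grind

/-! ### Congruences of the frame lattice -/

/-- The congruence of the frame lattice that identifies everything if `C` holds, and otherwise
forgets the distinction between the values `1` and `2` at the points of the down-set `K`. -/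
def con (C : Prop) (K : Set Q) (hK : IsLowerSet K) : LatticeCon (Frame Q) where
  r X Y := C ∨ (X.supp = Y.supp ∧ ∀ p ∉ K, p ∈ X.full ↔ p ∈ Y.full)
  iseqv :=
    { refl := fun X => .inr ⟨rfl, fun _ _ => Iff.rfl⟩
      symm := fun h => h.imp_right fun h => ⟨h.1.symm, fun p hp => (h.2 p hp).symm⟩
      trans := by
        rintro X Y Z (h | h) (h' | h')
        · exact .inl h
        · exact .inl h
        · exact .inl h'
        · exact .inr ⟨h.1.trans h'.1, fun p hp => (h.2 p hp).trans (h'.2 p hp)⟩ }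
  inf := by
    rintro X Y Z W (h | h) (h' | h')
    · exact .inl h
    · exact .inl h
    · exact .inl h'
    · exact .inr ⟨by rw [supp_inf, supp_inf, h.1, h'.1],
        fun p hp => and_congr (h.2 p hp) (h'.2 p hp)⟩
  sup := by
    rintro X Y Z W (h | h) (h' | h')
    · exact .inl h
    · exact .inl h
    · exact .inl h'
    · refine .inr ⟨?_, fun p hp => ?_⟩
      · ext j
        rw [mem_supp_sup, mem_supp_sup, h.1, h'.1]
      · rw [mem_full_sup, mem_full_sup, h.1, h'.1]
        refine imp_congr_right fun _ => and_congr_right fun _ => ?_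
        -- a point above `p ∉ K` is outside the down-set `K` as well
        refine exists_congr fun q => ⟨fun ⟨hq, hpq⟩ => ⟨?_, hpq⟩, fun ⟨hq, hpq⟩ => ⟨?_, hpq⟩⟩
        · have hqK : q ∉ K := fun hqK => hp (hK hpq hqK)
          exact hq.imp (h.2 q hqK).1 (h'.2 q hqK).1
        · have hqK : q ∉ K := fun hqK => hp (hK hpq hqK)
          exact hq.imp (h.2 q hqK).2 (h'.2 q hqK).2

theorem con_r {C : Prop} {K : Set Q} {hK : IsLowerSet K} {X Y : Frame Q} : (con C K hK).r X Y ↔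
    C ∨ (X.supp = Y.supp ∧ ∀ p ∉ K, p ∈ X.full ↔ p ∈ Y.full) := Iff.rfl

theorem con_bot_top {C : Prop} {K : Set Q} {hK : IsLowerSet K} :
    (con C K hK).r ⊥ ⊤ ↔ C := by
  simp [con_r, Set.empty_ne_univ]

theorem con_lo_hi {C : Prop} {K : Set Q} {hK : IsLowerSet K} {p : Q} :
    (con C K hK).r (lo p) (hi p) ↔ C ∨ p ∈ K := by
  rw [con_r]
  refine or_congr_right ⟨fun h => ?_, fun h => ⟨rfl, fun q hq => ?_⟩⟩
  · by_contra hp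
    simpa using h.2 p hp
  · have : q ≠ p := fun hqp => hq (hqp ▸ h)
    simpa using this

variable (φ : LatticeCon (Frame Q))

theorem r_of_bot_top (h : φ.r ⊥ ⊤) (X Y : Frame Q) : φ.r X Y :=
  φ.r_of_mem_interval h bot_le le_top bot_le le_top

/-- Identifying an atom with the bottom element identifies everything: joining with two extra
indices other than the given one identifies both of them with the top element, hence also their
meet, which is the bottom element. -/
theorem bot_top_of_bot_unit {j : Q ⊕ Fin 3} (h : φ.r ⊥ (unit j)) : φ.r ⊥ ⊤ := by
  have key : ∀ i : Fin 3, .inr i ≠ j → φ.r (unit (.inr i)) ⊤ := fun i hi => by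
    have := φ.sup_left (unit (.inr i)) h
    have hij : ¬ FrameComparable (.inr i) j := by
      cases j with
      | inl p => simp [FrameComparable]
      | inr k => simpa [FrameComparable] using hi
    rwa [sup_bot_eq, sup_eq_top (X := unit (.inr i)) (Y := unit j) rfl rfl hij] at this
  have : ∃ i k : Fin 3, i ≠ k ∧ (.inr i : Q ⊕ Fin 3) ≠ j ∧ (.inr k : Q ⊕ Fin 3) ≠ j := by
    cases j with
    | inl p => exact ⟨0, 1, by simp⟩
    | inr l =>
      simp only [ne_eq, Sum.inr.injEq]
      clear key h
      revert l
      decide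
  obtain ⟨i, k, hik, hi, hk⟩ := this
  have h' := φ.inf (key i hi) (key k hk)
  rwa [inf_idem, show unit (.inr i) ⊓ unit (.inr k) = (⊥ : Frame Q) by
    ext x <;> simp only [supp_inf, full_inf, supp_unit, full_unit, supp_bot, full_bot] <;> grind] at h'

/-- An interval whose ends have different supports generates the unit congruence. -/
theorem r_iff_of_supp_ne {X Y : Frame Q} (hXY : X ≤ Y) (h : X.supp ≠ Y.supp) :
    φ.r X Y ↔ φ.r ⊥ ⊤ := by
  refine ⟨fun hr => ?_, fun hr => r_of_bot_top φ hr X Y⟩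
  obtain ⟨j, hjY, hjX⟩ := Set.exists_of_ssubset (hXY.1.ssubset_of_ne h)
  refine bot_top_of_bot_unit φ (j := j) ?_
  have := φ.inf_left (unit j) hr
  rwa [show unit j ⊓ X = ⊥ by
      ext x <;> simp only [supp_inf, full_inf, supp_unit, full_unit, supp_bot, full_bot] <;> grind,
    inf_eq_left.2 (show unit j ≤ Y from ⟨by simpa using hjY, Set.empty_subset _⟩)] at this

theorem lo_hi_of_r {X Y : Frame Q} {p : Q} (hp : .inl p ∈ X.supp) (hpX : p ∉ X.full)
    (hpY : p ∈ Y.full) (h : φ.r X Y) : φ.r (lo p) (hi p) := by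
  have := φ.inf_left (hi p) h
  rwa [inf_eq_left.2 (hi_le_iff.2 hpY), show hi p ⊓ X = lo p by
    ext x <;> simp only [supp_inf, full_inf, supp_hi, full_hi, supp_lo, full_lo] <;> grind] at this

/-- The element `lo q ⊔ lo p` makes the colour `p` force the colours `q ≤ p`. -/
theorem lo_hi_mono {p q : Q} (hqp : q ≤ p) (h : φ.r (lo p) (hi p)) : φ.r (lo q) (hi q) := by
  have hc : IsFrameChain ({.inl q} ∪ {.inl p} : Set (Q ⊕ Fin 3)) := by
    rintro _ (rfl | rfl) _ (rfl | rfl) <;> simp [FrameComparable, hqp]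
  refine lo_hi_of_r φ (X := lo q ⊔ lo p) (Y := lo q ⊔ hi p) (mem_supp_sup.2 fun _ => .inl rfl)
    (fun h => ?_) (mem_full_sup.2 fun _ => ⟨.inl rfl, p, .inr rfl, hqp⟩) (φ.sup_left _ h)
  obtain ⟨r, hr, -⟩ := (mem_full_sup.1 h hc).2
  simp at hr

/-- An interval whose ends have the same support has as colour the largest point at which the ends
differ. -/
theorem exists_colour [Finite Q] {X Y : Frame Q} (hXY : X < Y) (h : X.supp = Y.supp) :
    ∃ p, .inl p ∈ X.supp ∧ ∀ φ : LatticeCon (Frame Q), φ.r X Y ↔ φ.r (lo p) (hi p) := by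
  have hne : X.full ≠ Y.full := fun h' => hXY.ne (Frame.ext h h')
  have hchain : IsFrameChain X.supp := by
    rcases X.chain with h' | h'
    · exact h'
    · exact absurd ⟨fun _ _ => h'.1.ge trivial, fun _ _ => h'.2.ge trivial⟩ hXY.not_ge
  obtain ⟨p, ⟨hpY, hpX⟩, hmax⟩ := (Set.toFinite (Y.full \ X.full)).exists_maximal
    (Set.exists_of_ssubset (hXY.le.2.ssubset_of_ne hne))
  have hp : .inl p ∈ X.supp := h ▸ Y.full_sub p hpY
  refine ⟨p, hp, fun φ => ⟨lo_hi_of_r φ hp hpX hpY, fun hr => ?_⟩⟩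
  have hr := φ.sup_left X hr
  rw [sup_eq_left.2 (lo_le_iff.2 hp)] at hr
  suffices Y ≤ X ⊔ hi p from φ.r_of_mem_interval hr le_rfl le_sup_left hXY.le this
  refine ⟨fun j hj _ => .inl (h ▸ hj), fun q hq _ => ?_⟩
  have hqX : .inl q ∈ X.supp := h ▸ Y.full_sub q hq
  refine ⟨.inl hqX, ?_⟩
  by_cases hqf : q ∈ X.full
  · exact ⟨q, .inl hqf, le_rfl⟩
  · refine ⟨p, .inr rfl, ?_⟩
    rcases hchain _ hp _ hqX with hle | hle
    · exact hmax ⟨hq, hqf⟩ hle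
    · exact hle

end Frame

/-! ### Inserting elements into squares of a lattice -/

/-- A family of squares `{r ⊓ s, r, s, r ⊔ s}` in a lattice; the condition `sep` keeps the elements
that are inserted into different squares incomparable. -/
structure SquareFamily (S C : Type u) [Lattice S] where
  r : C → S
  s : C → S
  not_r_le : ∀ c, ¬ r c ≤ s c
  not_s_le : ∀ c, ¬ s c ≤ r c
  sep : ∀ c c', ¬ r c ⊔ s c ≤ r c' ⊓ s c'

/-- The lattice `S` with one new element `inr c` in every square of the family, placed between the
bottom and the top of the square, so that the square becomes a diamond `M₃`. -/
def Inserted {S C : Type u} [Lattice S] (_ : SquareFamily S C) : Type u := S ⊕ C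

namespace Inserted

open scoped Classical

variable {S C : Type u} [Lattice S] {F : SquareFamily S C}

/-- An element of the original lattice. -/
def old (F : SquareFamily S C) (s : S) : Inserted F := Sum.inl s

/-- The element inserted into the square `c`. -/
def new (F : SquareFamily S C) (c : C) : Inserted F := Sum.inr c

@[elab_as_elim, induction_eliminator]
theorem ind {P : Inserted F → Prop} (old : ∀ s, P (old F s)) (new : ∀ c, P (new F c))
    (t : Inserted F) : P t :=
  match t with
  | .inl s => old s
  | .inr c => new c

/-- The order of the lattice with inserted elements. -/
def le : Inserted F → Inserted F → Prop
  | .inl s, .inl t => s ≤ t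
  | .inl s, .inr c => s ≤ F.r c ⊓ F.s c
  | .inr c, .inl s => F.r c ⊔ F.s c ≤ s
  | .inr c, .inr c' => c = c'

theorem bot_le_top (c : C) : F.r c ⊓ F.s c ≤ F.r c ⊔ F.s c := inf_le_sup

instance : PartialOrder (Inserted F) where
  le := le
  le_refl t := by
    cases t
    exacts [le_refl (α := S) _, rfl]
  le_trans := by
    rintro (a | a) (b | b) (c | c) h h'
    · exact le_trans (α := S) h h'
    · exact le_trans (α := S) h h'
    · exact le_trans (α := S) (le_trans (α := S) h (bot_le_top b)) h'
    · exact (show b = c from h') ▸ h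
    · exact le_trans (α := S) h h'
    · exact absurd (le_trans (α := S) h h') (F.sep _ _)
    · exact (show a = b from h) ▸ h'
    · exact Eq.trans h h'
  le_antisymm := by
    rintro (a | a) (b | b) h h'
    · exact congrArg Sum.inl (le_antisymm (α := S) h h')
    · exact absurd (le_trans (α := S) h' h) (F.sep _ _)
    · exact absurd (le_trans (α := S) h h') (F.sep _ _)
    · exact congrArg Sum.inr h

theorem old_le_old {s t : S} : old F s ≤ old F t ↔ s ≤ t := Iff.rfl

theorem old_le_new {s : S} {c : C} : old F s ≤ new F c ↔ s ≤ F.r c ⊓ F.s c := Iff.rfl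

theorem new_le_old {s : S} {c : C} : new F c ≤ old F s ↔ F.r c ⊔ F.s c ≤ s := Iff.rfl

theorem new_le_new {c c' : C} : new F c ≤ new F c' ↔ c = c' := Iff.rfl

/-- The join of the lattice with inserted elements. -/
noncomputable def sup : Inserted F → Inserted F → Inserted F
  | .inl s, .inl t => old F (s ⊔ t)
  | .inl s, .inr c => if s ≤ F.r c ⊓ F.s c then new F c else old F (s ⊔ (F.r c ⊔ F.s c))
  | .inr c, .inl s => if s ≤ F.r c ⊓ F.s c then new F c else old F (s ⊔ (F.r c ⊔ F.s c))
  | .inr c, .inr c' => if c = c' then new F c else old F ((F.r c ⊔ F.s c) ⊔ (F.r c' ⊔ F.s c'))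

/-- The meet of the lattice with inserted elements. -/
noncomputable def inf : Inserted F → Inserted F → Inserted F
  | .inl s, .inl t => old F (s ⊓ t)
  | .inl s, .inr c => if F.r c ⊔ F.s c ≤ s then new F c else old F (s ⊓ (F.r c ⊓ F.s c))
  | .inr c, .inl s => if F.r c ⊔ F.s c ≤ s then new F c else old F (s ⊓ (F.r c ⊓ F.s c))
  | .inr c, .inr c' => if c = c' then new F c else old F ((F.r c ⊓ F.s c) ⊓ (F.r c' ⊓ F.s c'))

theorem sup_comm' (a b : Inserted F) : sup a b = sup b a := by
  rcases a with a | a <;> rcases b with b | b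
  · exact congrArg (old F) (_root_.sup_comm _ _)
  · rfl
  · rfl
  · change ite _ _ _ = ite _ _ _
    by_cases h : a = b
    · rw [h]
    · rw [if_neg h, if_neg (Ne.symm h), _root_.sup_comm]

theorem inf_comm' (a b : Inserted F) : inf a b = inf b a := by
  rcases a with a | a <;> rcases b with b | b
  · exact congrArg (old F) (_root_.inf_comm _ _)
  · rfl
  · rfl
  · change ite _ _ _ = ite _ _ _
    by_cases h : a = b
    · rw [h]
    · rw [if_neg h, if_neg (Ne.symm h), _root_.inf_comm]

theorem le_sup_left' (a b : Inserted F) : a ≤ sup a b := by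
  rcases a with a | a <;> rcases b with b | b
  · exact old_le_old.2 le_sup_left
  · change old F a ≤ ite _ _ _
    split_ifs with h
    · exact h
    · exact old_le_old.2 le_sup_left
  · change new F a ≤ ite _ _ _
    split_ifs with h
    · exact le_rfl
    · exact new_le_old.2 le_sup_right
  · change new F a ≤ ite _ _ _
    split_ifs with h
    · exact le_rfl
    · exact new_le_old.2 le_sup_left

theorem inf_le_left' (a b : Inserted F) : inf a b ≤ a := by
  rcases a with a | a <;> rcases b with b | b
  · exact old_le_old.2 inf_le_left
  · change ite _ _ _ ≤ old F a
    split_ifs with h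
    · exact h
    · exact old_le_old.2 inf_le_left
  · change ite _ _ _ ≤ new F a
    split_ifs with h
    · exact le_rfl
    · exact old_le_new.2 inf_le_right
  · change ite _ _ _ ≤ new F a
    split_ifs with h
    · exact le_rfl
    · exact old_le_new.2 inf_le_left

theorem sup_old_new_le {a : S} {b : C} {t : Inserted F} (h : old F a ≤ t) (h' : new F b ≤ t) :
    sup (old F a) (new F b) ≤ t := by
  change ite _ _ _ ≤ t
  split_ifs with hab
  · exact h'
  · induction t with
    | old t => exact old_le_old.2 (sup_le h h')
    | new t => exact absurd (new_le_new.1 h' ▸ h) hab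

theorem le_inf_old_new {a : S} {b : C} {t : Inserted F} (h : t ≤ old F a) (h' : t ≤ new F b) :
    t ≤ inf (old F a) (new F b) := by
  change t ≤ ite _ _ _
  split_ifs with hab
  · exact h'
  · induction t with
    | old t => exact old_le_old.2 (le_inf h h')
    | new t => exact absurd (new_le_new.1 h' ▸ h) hab

noncomputable instance : Lattice (Inserted F) where
  sup := sup
  inf := inf
  le_sup_left := le_sup_left'
  le_sup_right a b := (le_sup_left' b a).trans_eq (sup_comm' b a)
  inf_le_left := inf_le_left'
  inf_le_right a b := (inf_comm' a b).trans_le (inf_le_left' b a)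
  sup_le a b t h h' := by
    induction a with
    | old a =>
      induction b with
      | old b =>
        induction t with
        | old t => exact old_le_old.2 (_root_.sup_le h h')
        | new t => exact old_le_new.2 (_root_.sup_le h h')
      | new b => exact sup_old_new_le h h'
    | new a =>
      induction b with
      | old b => exact sup_old_new_le h' h
      | new b =>
        change ite _ _ _ ≤ t
        split_ifs with hab
        · exact h
        · induction t with
          | old t => exact old_le_old.2 (_root_.sup_le (new_le_old.1 h) (new_le_old.1 h'))
          | new t => exact absurd (new_le_new.1 h |>.trans (new_le_new.1 h').symm) hab
  le_inf t a b h h' := by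
    induction a with
    | old a =>
      induction b with
      | old b =>
        induction t with
        | old t => exact old_le_old.2 (_root_.le_inf h h')
        | new t => exact new_le_old.2 (_root_.le_inf h h')
      | new b => exact le_inf_old_new h h'
    | new a =>
      induction b with
      | old b => exact le_inf_old_new h' h
      | new b =>
        change t ≤ ite _ _ _
        split_ifs with hab
        · exact h
        · induction t with
          | old t => exact old_le_old.2 (_root_.le_inf (old_le_new.1 h) (old_le_new.1 h'))
          | new t => exact absurd ((new_le_new.1 h).symm.trans (new_le_new.1 h')) hab

instance [Finite S] [Finite C] : Finite (Inserted F) := inferInstanceAs (Finite (S ⊕ C))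

instance [BoundedOrder S] : BoundedOrder (Inserted F) where
  bot := old F ⊥
  bot_le t := by
    induction t with
    | old s => exact old_le_old.2 bot_le
    | new c => exact old_le_new.2 bot_le
  top := old F ⊤
  le_top t := by
    induction t with
    | old s => exact old_le_old.2 le_top
    | new c => exact new_le_old.2 le_top

theorem old_sup_old (s t : S) : old F s ⊔ old F t = old F (s ⊔ t) := rfl

theorem old_inf_old (s t : S) : old F s ⊓ old F t = old F (s ⊓ t) := rfl

theorem new_sup_old_of_not_le {c : C} {s : S} (h : ¬ s ≤ F.r c ⊓ F.s c) :
    new F c ⊔ old F s = old F (s ⊔ (F.r c ⊔ F.s c)) := if_neg h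

theorem new_inf_old_of_not_le {c : C} {s : S} (h : ¬ F.r c ⊔ F.s c ≤ s) :
    new F c ⊓ old F s = old F (s ⊓ (F.r c ⊓ F.s c)) := if_neg h

theorem new_sup_new_of_ne {c c' : C} (h : c ≠ c') :
    new F c ⊔ new F c' = old F ((F.r c ⊔ F.s c) ⊔ (F.r c' ⊔ F.s c')) := if_neg h

theorem new_inf_new_of_ne {c c' : C} (h : c ≠ c') :
    new F c ⊓ new F c' = old F ((F.r c ⊓ F.s c) ⊓ (F.r c' ⊓ F.s c')) := if_neg h

/-- The inclusion of the original lattice. -/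
def incl (F : SquareFamily S C) : LatticeHom S (Inserted F) where
  toFun := old F
  map_sup' _ _ := rfl
  map_inf' _ _ := rfl

/-! ### Congruences of a lattice with inserted elements -/

section Collapse

variable (φ : LatticeCon (Inserted F)) (c : C)

theorem new_sup_r : new F c ⊔ old F (F.r c) = old F (F.r c ⊔ F.s c) := by
  rw [new_sup_old_of_not_le fun h => F.not_r_le c (h.trans inf_le_right), sup_left_idem]

theorem new_sup_s : new F c ⊔ old F (F.s c) = old F (F.r c ⊔ F.s c) := by
  rw [new_sup_old_of_not_le fun h => F.not_s_le c (h.trans inf_le_left), sup_left_comm, sup_idem]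

theorem new_inf_r : new F c ⊓ old F (F.r c) = old F (F.r c ⊓ F.s c) := by
  rw [new_inf_old_of_not_le fun h => F.not_s_le c (le_sup_right.trans h), inf_left_idem]

theorem new_inf_s : new F c ⊓ old F (F.s c) = old F (F.r c ⊓ F.s c) := by
  rw [new_inf_old_of_not_le fun h => F.not_r_le c (le_sup_left.trans h), inf_left_comm, inf_idem]

theorem r_new_top_of_r_bot_r (h : φ.r (old F (F.r c ⊓ F.s c)) (old F (F.r c))) :
    φ.r (new F c) (old F (F.r c ⊔ F.s c)) := by
  have := φ.sup_left (new F c) h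
  rwa [new_sup_r, sup_eq_left.2 (old_le_new.2 le_rfl)] at this

theorem r_new_top_of_r_bot_s (h : φ.r (old F (F.r c ⊓ F.s c)) (old F (F.s c))) :
    φ.r (new F c) (old F (F.r c ⊔ F.s c)) := by
  have := φ.sup_left (new F c) h
  rwa [new_sup_s, sup_eq_left.2 (old_le_new.2 le_rfl)] at this

theorem r_bot_r_of_r_new_top (h : φ.r (new F c) (old F (F.r c ⊔ F.s c))) :
    φ.r (old F (F.r c ⊓ F.s c)) (old F (F.r c)) := by
  have := φ.inf_left (old F (F.r c)) h
  rwa [inf_comm, new_inf_r, old_inf_old, inf_sup_self] at this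

theorem r_bot_s_of_r_new_top (h : φ.r (new F c) (old F (F.r c ⊔ F.s c))) :
    φ.r (old F (F.r c ⊓ F.s c)) (old F (F.s c)) := by
  have := φ.inf_left (old F (F.s c)) h
  rwa [inf_comm, new_inf_s, old_inf_old,
    inf_eq_left.2 (le_sup_right : F.s c ≤ F.r c ⊔ F.s c)] at this

/-- The two sides of a square are collapsed together, because the inserted element is a common
complement of them in the square. -/
theorem r_bot_r_iff_r_bot_s : φ.r (old F (F.r c ⊓ F.s c)) (old F (F.r c)) ↔
    φ.r (old F (F.r c ⊓ F.s c)) (old F (F.s c)) :=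
  ⟨fun h => r_bot_s_of_r_new_top φ c (r_new_top_of_r_bot_r φ c h),
    fun h => r_bot_r_of_r_new_top φ c (r_new_top_of_r_bot_s φ c h)⟩

theorem r_bot_top_of_r_bot_r (h : φ.r (old F (F.r c ⊓ F.s c)) (old F (F.r c))) :
    φ.r (old F (F.r c ⊓ F.s c)) (old F (F.r c ⊔ F.s c)) := by
  have := φ.sup h ((r_bot_r_iff_r_bot_s φ c).1 h)
  rwa [sup_idem, old_sup_old] at this

theorem r_bot_r_of_r_bot_new (h : φ.r (old F (F.r c ⊓ F.s c)) (new F c)) :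
    φ.r (old F (F.r c ⊓ F.s c)) (old F (F.r c)) := by
  rw [r_bot_r_iff_r_bot_s]
  have := φ.inf_left (old F (F.s c)) (φ.sup_left (old F (F.r c)) h)
  rwa [sup_comm _ (new F c), new_sup_r, old_sup_old, old_inf_old, old_inf_old, sup_inf_self,
    inf_comm (F.s c) (F.r c), inf_eq_left.2 (le_sup_right : F.s c ≤ F.r c ⊔ F.s c)] at this

theorem r_new_old_iff {s : S} (h : F.r c ⊔ F.s c ≤ s) :
    φ.r (new F c) (old F s) ↔ φ.r (old F (F.r c ⊓ F.s c)) (old F s) := by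
  have h₀ : old F (F.r c ⊓ F.s c) ≤ new F c := old_le_new.2 le_rfl
  refine ⟨fun hr => ?_, fun hr => φ.r_of_mem_interval hr h₀ (new_le_old.2 h)
    (h₀.trans (new_le_old.2 h)) le_rfl⟩
  have hv := r_bot_top_of_r_bot_r φ c <| r_bot_r_of_r_new_top φ c <|
    φ.r_of_mem_interval hr le_rfl (new_le_old.2 h) (new_le_old.2 le_rfl) (old_le_old.2 h)
  exact φ.iseqv.trans (φ.r_of_mem_interval hv le_rfl (old_le_old.2 inf_le_sup) h₀
    (new_le_old.2 le_rfl)) hr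

theorem r_old_new_iff {s : S} (h : s ≤ F.r c ⊓ F.s c) :
    φ.r (old F s) (new F c) ↔ φ.r (old F s) (old F (F.r c ⊔ F.s c)) := by
  have h₀ : new F c ≤ old F (F.r c ⊔ F.s c) := new_le_old.2 le_rfl
  refine ⟨fun hr => ?_, fun hr => φ.r_of_mem_interval hr le_rfl ((old_le_new.2 h).trans h₀)
    (old_le_new.2 h) h₀⟩
  have hv := r_bot_top_of_r_bot_r φ c <| r_bot_r_of_r_bot_new φ c <|
    φ.r_of_mem_interval hr (old_le_old.2 h) (old_le_new.2 le_rfl) (old_le_new.2 h) le_rfl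
  exact φ.iseqv.trans hr (φ.r_of_mem_interval hv (old_le_new.2 le_rfl) h₀
    (old_le_old.2 inf_le_sup) le_rfl)

end Collapse

section Extend

/-- The element of the original lattice that represents a given element in the quotients in which it
is not isolated: the inserted elements are represented by the bottom of their square. -/
def base : Inserted F → S
  | .inl s => s
  | .inr c => F.r c ⊓ F.s c

/-- All elements except those inserted into the squares outside `K`. -/
def Good (K : Set C) : Inserted F → Prop
  | .inl _ => True
  | .inr c => c ∈ K

variable {ψ : LatticeCon S} {K : Set C}

theorem good_sup (hK : ∀ c ∈ K, ψ.r (F.r c ⊓ F.s c) (F.r c ⊔ F.s c))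
    {z t : Inserted F} (hz : Good K z) (ht : Good K t) :
    Good K (z ⊔ t) ∧ ψ.r (base (z ⊔ t)) (base z ⊔ base t) := by
  have key : ∀ (s : S) (c : C), c ∈ K → Good K (old F s ⊔ new F c) ∧
      ψ.r (base (old F s ⊔ new F c)) (s ⊔ (F.r c ⊓ F.s c)) := by
    intro s c hc
    by_cases h : s ≤ F.r c ⊓ F.s c
    · rw [sup_eq_right.2 (old_le_new.2 h), sup_eq_right.2 h]
      exact ⟨hc, ψ.r_self _⟩
    · rw [sup_comm, new_sup_old_of_not_le h]
      exact ⟨trivial, ψ.sup_left _ (ψ.iseqv.symm (hK c hc))⟩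
  induction z with
  | old z =>
    induction t with
    | old t => exact ⟨trivial, ψ.r_self _⟩
    | new t => exact key z t ht
  | new z =>
    induction t with
    | old t =>
      rw [sup_comm, sup_comm (base _)]
      exact key t z hz
    | new t =>
      by_cases h : z = t
      · subst h
        rw [sup_idem, sup_idem]
        exact ⟨hz, ψ.r_self _⟩
      · rw [new_sup_new_of_ne h]
        exact ⟨trivial, ψ.iseqv.symm (ψ.sup (hK z hz) (hK t ht))⟩

theorem good_inf {z t : Inserted F} (hz : Good K z) (ht : Good K t) :
    Good K (z ⊓ t) ∧ ψ.r (base (z ⊓ t)) (base z ⊓ base t) := by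
  have key : ∀ (s : S) (c : C), c ∈ K → Good K (old F s ⊓ new F c) ∧
      ψ.r (base (old F s ⊓ new F c)) (s ⊓ (F.r c ⊓ F.s c)) := by
    intro s c hc
    by_cases h : F.r c ⊔ F.s c ≤ s
    · rw [inf_eq_right.2 (new_le_old.2 h), inf_eq_right.2 (inf_le_sup.trans h)]
      exact ⟨hc, ψ.r_self _⟩
    · rw [inf_comm, new_inf_old_of_not_le h]
      exact ⟨trivial, ψ.r_self _⟩
  induction z with
  | old z =>
    induction t with
    | old t => exact ⟨trivial, ψ.r_self _⟩
    | new t => exact key z t ht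
  | new z =>
    induction t with
    | old t =>
      rw [inf_comm, inf_comm (base _)]
      exact key t z hz
    | new t =>
      by_cases h : z = t
      · subst h
        rw [inf_idem, inf_idem]
        exact ⟨hz, ψ.r_self _⟩
      · rw [new_inf_new_of_ne h]
        exact ⟨trivial, ψ.r_self _⟩

theorem new_sup_good (hK : ∀ c ∈ K, ψ.r (F.r c ⊓ F.s c) (F.r c ⊔ F.s c))
    (hKw : ∀ c ∉ K, ∀ s t, ψ.r s t → s ≤ F.r c ⊓ F.s c → t ≤ F.r c ⊓ F.s c)
    {c : C} (hc : c ∉ K) {t : Inserted F} (ht : Good K t) :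
    (base t ≤ F.r c ⊓ F.s c → new F c ⊔ t = new F c) ∧
    (¬ base t ≤ F.r c ⊓ F.s c → ∃ s, new F c ⊔ t = old F s ∧ ψ.r s (base t ⊔ (F.r c ⊔ F.s c))) := by
  induction t with
  | old t =>
    exact ⟨fun h => sup_eq_left.2 (old_le_new.2 h),
      fun h => ⟨_, new_sup_old_of_not_le h, ψ.r_self _⟩⟩
  | new t =>
    refine ⟨fun h => absurd (hKw c hc _ _ (hK t ht) h) (F.sep _ _), fun _ => ?_⟩
    refine ⟨_, new_sup_new_of_ne fun h => hc (h ▸ ht), ?_⟩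
    rw [sup_comm]
    exact ψ.sup (ψ.iseqv.symm (hK t ht)) (ψ.r_self _)

theorem new_inf_good {c : C} (hc : c ∉ K) {t : Inserted F} (ht : Good K t) :
    (F.r c ⊔ F.s c ≤ base t → new F c ⊓ t = new F c) ∧
    (¬ F.r c ⊔ F.s c ≤ base t → new F c ⊓ t = old F (base t ⊓ (F.r c ⊓ F.s c))) := by
  induction t with
  | old t =>
    exact ⟨fun h => inf_eq_left.2 (new_le_old.2 h), fun h => new_inf_old_of_not_le h⟩
  | new t =>
    refine ⟨fun h => absurd h (F.sep _ _), fun _ => ?_⟩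
    have hne : c ≠ t := fun h => hc (h ▸ ht)
    rw [new_inf_new_of_ne hne, inf_comm]
    rfl

/-- The extension of a congruence `ψ` of the original lattice that isolates exactly the elements
inserted into the squares outside `K`. It exists if `ψ` collapses the squares in `K` and, for the other
squares, respects the ideal below the bottom and the filter above the top. -/
def extend (ψ : LatticeCon S) (K : Set C)
    (hK : ∀ c ∈ K, ψ.r (F.r c ⊓ F.s c) (F.r c ⊔ F.s c))
    (hKw : ∀ c ∉ K, ∀ s t, ψ.r s t → s ≤ F.r c ⊓ F.s c → t ≤ F.r c ⊓ F.s c)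
    (hKv : ∀ c ∉ K, ∀ s t, ψ.r s t → F.r c ⊔ F.s c ≤ s → F.r c ⊔ F.s c ≤ t) :
    LatticeCon (Inserted F) :=
  have supL : ∀ {x y : Inserted F} (z : Inserted F),
      (x = y ∨ Good K x ∧ Good K y ∧ ψ.r (base x) (base y)) →
      (z ⊔ x = z ⊔ y ∨ Good K (z ⊔ x) ∧ Good K (z ⊔ y) ∧ ψ.r (base (z ⊔ x)) (base (z ⊔ y))) := by
    rintro x y z (rfl | ⟨hx, hy, h⟩)
    · exact .inl rfl
    by_cases hz : Good K z
    · have h₁ := good_sup hK hz hx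
      have h₂ := good_sup hK hz hy
      exact .inr ⟨h₁.1, h₂.1,
        ψ.iseqv.trans h₁.2 (ψ.iseqv.trans (ψ.sup_left _ h) (ψ.iseqv.symm h₂.2))⟩
    induction z with
    | old z => exact absurd trivial hz
    | new c =>
      have h₁ := new_sup_good hK hKw hz hx
      have h₂ := new_sup_good hK hKw hz hy
      by_cases hw : base x ≤ F.r c ⊓ F.s c
      · rw [h₁.1 hw, h₂.1 (hKw c hz _ _ h hw)]
        exact .inl rfl
      · obtain ⟨s, hs, hs'⟩ := h₁.2 hw
        obtain ⟨t, ht, ht'⟩ := h₂.2 fun hw' => hw (hKw c hz _ _ (ψ.iseqv.symm h) hw')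
        rw [hs, ht]
        exact .inr ⟨trivial, trivial,
          ψ.iseqv.trans hs' (ψ.iseqv.trans (ψ.sup h (ψ.r_self _)) (ψ.iseqv.symm ht'))⟩
  have infL : ∀ {x y : Inserted F} (z : Inserted F),
      (x = y ∨ Good K x ∧ Good K y ∧ ψ.r (base x) (base y)) →
      (z ⊓ x = z ⊓ y ∨ Good K (z ⊓ x) ∧ Good K (z ⊓ y) ∧ ψ.r (base (z ⊓ x)) (base (z ⊓ y))) := by
    rintro x y z (rfl | ⟨hx, hy, h⟩)
    · exact .inl rfl
    by_cases hz : Good K z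
    · have h₁ := good_inf (ψ := ψ) hz hx
      have h₂ := good_inf (ψ := ψ) hz hy
      exact .inr ⟨h₁.1, h₂.1,
        ψ.iseqv.trans h₁.2 (ψ.iseqv.trans (ψ.inf_left _ h) (ψ.iseqv.symm h₂.2))⟩
    induction z with
    | old z => exact absurd trivial hz
    | new c =>
      have h₁ := new_inf_good hz hx
      have h₂ := new_inf_good hz hy
      by_cases hv : F.r c ⊔ F.s c ≤ base x
      · rw [h₁.1 hv, h₂.1 (hKv c hz _ _ h hv)]
        exact .inl rfl
      · rw [h₁.2 hv, h₂.2 fun hv' => hv (hKv c hz _ _ (ψ.iseqv.symm h) hv')]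
        exact .inr ⟨trivial, trivial, ψ.inf h (ψ.r_self _)⟩
  have trans : ∀ {x y z : Inserted F},
      (x = y ∨ Good K x ∧ Good K y ∧ ψ.r (base x) (base y)) →
      (y = z ∨ Good K y ∧ Good K z ∧ ψ.r (base y) (base z)) →
      (x = z ∨ Good K x ∧ Good K z ∧ ψ.r (base x) (base z)) := by
    rintro x y z (rfl | h) (rfl | h')
    · exact .inl rfl
    · exact .inr h'
    · exact .inr h
    · exact .inr ⟨h.1, h'.2.1, ψ.iseqv.trans h.2.2 h'.2.2⟩
  { r := fun x y => x = y ∨ Good K x ∧ Good K y ∧ ψ.r (base x) (base y)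
    iseqv :=
      { refl := fun _ => .inl rfl
        symm := fun h => h.imp Eq.symm fun h => ⟨h.2.1, h.1, ψ.iseqv.symm h.2.2⟩
        trans := trans }
    inf := fun {_ x y _} h h' => trans (by rw [inf_comm _ y, inf_comm _ y]; exact infL y h) (infL x h')
    sup := fun {_ x y _} h h' => trans (by rw [sup_comm _ y, sup_comm _ y]; exact supL y h) (supL x h') }

theorem extend_r_old {ψ : LatticeCon S} {K : Set C}
    {hK : ∀ c ∈ K, ψ.r (F.r c ⊓ F.s c) (F.r c ⊔ F.s c)}
    {hKw : ∀ c ∉ K, ∀ s t, ψ.r s t → s ≤ F.r c ⊓ F.s c → t ≤ F.r c ⊓ F.s c}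
    {hKv : ∀ c ∉ K, ∀ s t, ψ.r s t → F.r c ⊔ F.s c ≤ s → F.r c ⊔ F.s c ≤ t} {s t : S} :
    (extend ψ K hK hKw hKv).r (old F s) (old F t) ↔ ψ.r s t := by
  refine ⟨?_, fun h => .inr ⟨trivial, trivial, h⟩⟩
  rintro (h | h)
  · exact Sum.inl_injective h ▸ ψ.r_self _
  · exact h.2.2

end Extend
end Inserted

/-! ### Gluing two frame lattices -/

section Glue

open OrderDual

variable {Q₁ Q₂ C : Type u} [PartialOrder Q₁] [PartialOrder Q₂]

/-- The dual of `Frame Q₁` glued below `Frame Q₂`, as a sublattice of their product: the lower part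
consists of the pairs `(x, ⊥)`, the upper part of the pairs `(⊥, y)` (where `⊥` is the top element of
the dual), and for every common colour `c` there are the pairs `(x, y)` with `x ≤ hi c` and
`y ≤ hi c`. The latter add to the two parts the prime square spanned by the intervals of colour
`c`. -/
def glue (i₁ : C ↪ Q₁) (i₂ : C ↪ Q₂) : Sublattice ((Frame Q₁)ᵒᵈ × Frame Q₂) where
  carrier := {z | z.2 = ⊥ ∨ ofDual z.1 = ⊥ ∨
    ∃ c, ofDual z.1 ≤ Frame.hi (i₁ c) ∧ z.2 ≤ Frame.hi (i₂ c)}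
  supClosed' := by
    have key : ∀ {x x' : Frame Q₁} {c : C}, x ≤ Frame.hi (i₁ c) → x ⊓ x' ≤ Frame.hi (i₁ c) :=
      fun h => inf_le_left.trans h
    rintro ⟨x, y⟩ h ⟨x', y'⟩ h'
    change y ⊔ y' = ⊥ ∨ ofDual x ⊓ ofDual x' = ⊥ ∨
      ∃ c, ofDual x ⊓ ofDual x' ≤ Frame.hi (i₁ c) ∧ y ⊔ y' ≤ Frame.hi (i₂ c)
    change y = ⊥ ∨ ofDual x = ⊥ ∨ ∃ c, ofDual x ≤ Frame.hi (i₁ c) ∧ y ≤ Frame.hi (i₂ c) at h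
    change y' = ⊥ ∨ ofDual x' = ⊥ ∨ ∃ c, ofDual x' ≤ Frame.hi (i₁ c) ∧ y' ≤ Frame.hi (i₂ c) at h'
    rcases h with rfl | h | ⟨c, hx, hy⟩
    · rcases h' with rfl | h' | ⟨c, hx', hy'⟩
      · exact .inl (sup_idem _)
      · exact .inr (.inl (by rw [h', inf_bot_eq]))
      · exact .inr (.inr ⟨c, inf_le_right.trans hx', by rwa [bot_sup_eq]⟩)
    · exact .inr (.inl (by rw [h, bot_inf_eq]))
    · rcases h' with rfl | h' | ⟨c', hx', hy'⟩
      · exact .inr (.inr ⟨c, key hx, by rwa [sup_bot_eq]⟩)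
      · exact .inr (.inl (by rw [h', inf_bot_eq]))
      · by_cases hc : c = c'
        · subst hc
          exact .inr (.inr ⟨c, key hx, sup_le hy hy'⟩)
        · refine .inr (.inl (le_bot_iff.1 ?_))
          rw [← Frame.hi_inf_hi_of_ne (i₁.injective.ne hc)]
          exact inf_le_inf hx hx'
  infClosed' := by
    have key : ∀ {y y' : Frame Q₂} {c : C}, y ≤ Frame.hi (i₂ c) → y ⊓ y' ≤ Frame.hi (i₂ c) :=
      fun h => inf_le_left.trans h
    rintro ⟨x, y⟩ h ⟨x', y'⟩ h'
    change y ⊓ y' = ⊥ ∨ ofDual x ⊔ ofDual x' = ⊥ ∨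
      ∃ c, ofDual x ⊔ ofDual x' ≤ Frame.hi (i₁ c) ∧ y ⊓ y' ≤ Frame.hi (i₂ c)
    change y = ⊥ ∨ ofDual x = ⊥ ∨ ∃ c, ofDual x ≤ Frame.hi (i₁ c) ∧ y ≤ Frame.hi (i₂ c) at h
    change y' = ⊥ ∨ ofDual x' = ⊥ ∨ ∃ c, ofDual x' ≤ Frame.hi (i₁ c) ∧ y' ≤ Frame.hi (i₂ c) at h'
    rcases h with h | h | ⟨c, hx, hy⟩
    · exact .inl (by rw [h, bot_inf_eq])
    · rcases h' with h' | h' | ⟨c, hx', hy'⟩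
      · exact .inl (by rw [h', inf_bot_eq])
      · exact .inr (.inl (by rw [h, h', sup_idem]))
      · exact .inr (.inr ⟨c, by rwa [h, bot_sup_eq], inf_le_right.trans hy'⟩)
    · rcases h' with h' | h' | ⟨c', hx', hy'⟩
      · exact .inl (by rw [h', inf_bot_eq])
      · exact .inr (.inr ⟨c, by rwa [h', sup_bot_eq], key hy⟩)
      · by_cases hc : c = c'
        · subst hc
          exact .inr (.inr ⟨c, sup_le hx hx', key hy⟩)
        · refine .inl (le_bot_iff.1 ?_)
          rw [← Frame.hi_inf_hi_of_ne (i₂.injective.ne hc)]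
          exact inf_le_inf hy hy'

namespace glue

variable {i₁ : C ↪ Q₁} {i₂ : C ↪ Q₂}

/-- The component of an element of the glued lattice in `Frame Q₁`; it is antitone. -/
def fst (s : glue i₁ i₂) : Frame Q₁ := ofDual s.1.1

/-- The component of an element of the glued lattice in `Frame Q₂`. -/
def snd (s : glue i₁ i₂) : Frame Q₂ := s.1.2

theorem mem (s : glue i₁ i₂) : snd s = ⊥ ∨ fst s = ⊥ ∨
    ∃ c, fst s ≤ Frame.hi (i₁ c) ∧ snd s ≤ Frame.hi (i₂ c) := s.2

/-- The element of the glued lattice with given components. -/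
def mk (x : Frame Q₁) (y : Frame Q₂)
    (h : y = ⊥ ∨ x = ⊥ ∨ ∃ c, x ≤ Frame.hi (i₁ c) ∧ y ≤ Frame.hi (i₂ c)) : glue i₁ i₂ :=
  ⟨(toDual x, y), h⟩

theorem le_iff {s t : glue i₁ i₂} : s ≤ t ↔ fst t ≤ fst s ∧ snd s ≤ snd t := Iff.rfl

theorem ext {s t : glue i₁ i₂} (h : fst s = fst t) (h' : snd s = snd t) : s = t :=
  Subtype.ext (Prod.ext h h')

@[simp] theorem fst_sup (s t : glue i₁ i₂) : fst (s ⊔ t) = fst s ⊓ fst t := rfl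

@[simp] theorem fst_inf (s t : glue i₁ i₂) : fst (s ⊓ t) = fst s ⊔ fst t := rfl

@[simp] theorem snd_sup (s t : glue i₁ i₂) : snd (s ⊔ t) = snd s ⊔ snd t := rfl

@[simp] theorem snd_inf (s t : glue i₁ i₂) : snd (s ⊓ t) = snd s ⊓ snd t := rfl

@[simp] theorem fst_mk (x : Frame Q₁) (y : Frame Q₂) (h) : fst (mk (i₁ := i₁) (i₂ := i₂) x y h) = x :=
  rfl

@[simp] theorem snd_mk (x : Frame Q₁) (y : Frame Q₂) (h) : snd (mk (i₁ := i₁) (i₂ := i₂) x y h) = y :=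
  rfl

instance : BoundedOrder (glue i₁ i₂) where
  bot := mk ⊤ ⊥ (.inl rfl)
  bot_le _ := le_iff.2 ⟨le_top, bot_le⟩
  top := mk ⊥ ⊤ (.inr (.inl rfl))
  le_top _ := le_iff.2 ⟨bot_le, le_top⟩

instance [Finite Q₁] [Finite Q₂] : Finite (glue i₁ i₂) :=
  Finite.of_injective (fun s : glue i₁ i₂ => (fst s, snd s)) fun _ _ h =>
    ext (congrArg Prod.fst h) (congrArg Prod.snd h)

/-- The inclusion of the lower part. -/
def inclLower (i₁ : C ↪ Q₁) (i₂ : C ↪ Q₂) : LatticeHom (Frame Q₁)ᵒᵈ (glue i₁ i₂) where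
  toFun x := mk (ofDual x) ⊥ (.inl rfl)
  map_sup' _ _ := ext rfl (sup_idem _).symm
  map_inf' _ _ := ext rfl (inf_idem _).symm

/-- The inclusion of the upper part. -/
def inclUpper (i₁ : C ↪ Q₁) (i₂ : C ↪ Q₂) : LatticeHom (Frame Q₂) (glue i₁ i₂) where
  toFun y := mk ⊥ y (.inr (.inl rfl))
  map_sup' _ _ := ext (inf_idem _).symm rfl
  map_inf' _ _ := ext (sup_idem _).symm rfl

/-- A congruence of the glued lattice, restricted to the lower part. -/
def lower (φ : LatticeCon (glue i₁ i₂)) : LatticeCon (Frame Q₁) := (φ.comap (inclLower i₁ i₂)).ofDual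

/-- A congruence of the glued lattice, restricted to the upper part. -/
def upper (φ : LatticeCon (glue i₁ i₂)) : LatticeCon (Frame Q₂) := φ.comap (inclUpper i₁ i₂)

theorem lower_r {φ : LatticeCon (glue i₁ i₂)} {x x' : Frame Q₁} :
    (lower φ).r x x' ↔ φ.r (mk x ⊥ (.inl rfl)) (mk x' ⊥ (.inl rfl)) := Iff.rfl

theorem upper_r {φ : LatticeCon (glue i₁ i₂)} {y y' : Frame Q₂} :
    (upper φ).r y y' ↔ φ.r (mk ⊥ y (.inr (.inl rfl))) (mk ⊥ y' (.inr (.inl rfl))) := Iff.rfl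

/-- Congruences of the glued lattice act componentwise on comparable pairs. -/
theorem r_iff (φ : LatticeCon (glue i₁ i₂)) {s t : glue i₁ i₂} (h : s ≤ t) :
    φ.r s t ↔ (lower φ).r (fst t) (fst s) ∧ (upper φ).r (snd s) (snd t) := by
  rw [le_iff] at h
  constructor
  · refine fun hr => ⟨(lower φ).iseqv.symm ?_, ?_⟩
    · have := φ.inf_left (mk ⊥ ⊥ (.inl rfl)) hr
      rw [lower_r]
      convert this using 1 <;> exact ext (by simp) (by simp)
    · have := φ.sup_left (mk ⊥ ⊥ (.inl rfl)) hr
      rw [upper_r]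
      convert this using 1 <;> exact ext (by simp) (by simp)
  · rintro ⟨h₁, h₂⟩
    have hmem : snd s = ⊥ ∨ fst t = ⊥ ∨
        ∃ c, fst t ≤ Frame.hi (i₁ c) ∧ snd s ≤ Frame.hi (i₂ c) := by
      rcases mem s with h' | h' | ⟨c, h', h''⟩
      · exact .inl h'
      · exact .inr (.inl (le_bot_iff.1 (h' ▸ h.1)))
      · exact .inr (.inr ⟨c, h.1.trans h', h''⟩)
    refine φ.iseqv.trans (y := mk (fst t) (snd s) hmem) ?_ ?_
    · have := φ.sup_left s ((lower φ).iseqv.symm h₁)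
      convert this using 1 <;> refine ext ?_ ?_ <;> simp [inclLower, h.1]
    · have := φ.inf_left t h₂
      convert this using 1 <;> refine ext ?_ ?_ <;> simp [inclUpper, h.2]

/-- The congruence of the glued lattice with given restrictions. -/
def con (A : LatticeCon (Frame Q₁)) (B : LatticeCon (Frame Q₂)) : LatticeCon (glue i₁ i₂) where
  r s t := A.r (fst s) (fst t) ∧ B.r (snd s) (snd t)
  iseqv := ⟨fun _ => ⟨A.r_self _, B.r_self _⟩,
    fun h => ⟨A.iseqv.symm h.1, B.iseqv.symm h.2⟩,
    fun h h' => ⟨A.iseqv.trans h.1 h'.1, B.iseqv.trans h.2 h'.2⟩⟩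
  inf h h' := ⟨A.sup h.1 h'.1, B.inf h.2 h'.2⟩
  sup h h' := ⟨A.inf h.1 h'.1, B.sup h.2 h'.2⟩

theorem con_r {A : LatticeCon (Frame Q₁)} {B : LatticeCon (Frame Q₂)} {s t : glue i₁ i₂} :
    (con A B).r s t ↔ A.r (fst s) (fst t) ∧ B.r (snd s) (snd t) := Iff.rfl

/-- The prime squares of the common colours. -/
def squares (i₁ : C ↪ Q₁) (i₂ : C ↪ Q₂) : SquareFamily (glue i₁ i₂) C where
  r c := mk (.lo (i₁ c)) (.lo (i₂ c)) (.inr (.inr ⟨c, Frame.lo_le_hi _, Frame.lo_le_hi _⟩))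
  s c := mk (.hi (i₁ c)) (.hi (i₂ c)) (.inr (.inr ⟨c, le_rfl, le_rfl⟩))
  not_r_le _ h := Frame.not_hi_le_lo _ _ (le_iff.1 h).1
  not_s_le _ h := Frame.not_hi_le_lo _ _ (le_iff.1 h).2
  sep _ _ h := Frame.not_hi_le_lo _ _ <|
    (le_sup_right (α := Frame Q₂)).trans ((le_iff.1 h).2.trans inf_le_left)

theorem bot_le_iff {c : C} {s : glue i₁ i₂} :
    s ≤ (squares i₁ i₂).r c ⊓ (squares i₁ i₂).s c ↔
      Frame.hi (i₁ c) ≤ fst s ∧ snd s ≤ Frame.lo (i₂ c) := by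
  rw [le_iff]
  simp [squares, Frame.lo_le_hi]

theorem le_top_iff {c : C} {s : glue i₁ i₂} :
    (squares i₁ i₂).r c ⊔ (squares i₁ i₂).s c ≤ s ↔
      fst s ≤ Frame.lo (i₁ c) ∧ Frame.hi (i₂ c) ≤ snd s := by
  rw [le_iff]
  simp [squares, Frame.lo_le_hi]

/-- In the lattice with the inserted elements, the two intervals of a common colour are collapsed by
the same congruences. -/
theorem lower_lo_hi_iff (φ : LatticeCon (Inserted (squares i₁ i₂))) (c : C) :
    (lower (φ.comap (Inserted.incl _))).r (.lo (i₁ c)) (.hi (i₁ c)) ↔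
      (upper (φ.comap (Inserted.incl _))).r (.lo (i₂ c)) (.hi (i₂ c)) := by
  have h := Inserted.r_bot_r_iff_r_bot_s φ c
  have h₁ := r_iff (φ.comap (Inserted.incl _))
    (inf_le_left : (squares i₁ i₂).r c ⊓ (squares i₁ i₂).s c ≤ _)
  have h₂ := r_iff (φ.comap (Inserted.incl _))
    (inf_le_right : (squares i₁ i₂).r c ⊓ (squares i₁ i₂).s c ≤ _)
  have e₁ : fst ((squares i₁ i₂).r c ⊓ (squares i₁ i₂).s c) = .hi (i₁ c) := by
    simp [squares, Frame.lo_le_hi]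
  have e₂ : snd ((squares i₁ i₂).r c ⊓ (squares i₁ i₂).s c) = .lo (i₂ c) := by
    simp [squares, Frame.lo_le_hi]
  rw [e₁, e₂] at h₁ h₂
  refine ((h₁.trans ?_).symm.trans h).trans (h₂.trans ?_)
  · exact and_iff_left (LatticeCon.r_self _ _)
  · exact and_iff_right (LatticeCon.r_self _ _)

end glue

end Glue

/-! ### Frame lattices coloured by join-irreducible elements -/

section Colours

variable {D : Type u} [DistribLattice D]

/-- The join-irreducible elements strictly below `m`. -/
abbrev IrredBelow (m : D) : Type u := {p : D // SupIrred p ∧ p < m}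

/-- The congruence `φ` of the frame lattice of `IrredBelow m` collapses the colour `p`, where `p = m`
is the colour of the intervals that generate the unit congruence. -/
def FrameCol (m : D) (φ : LatticeCon (Frame (IrredBelow m))) (p : D) : Prop :=
  (p = m → φ.r ⊥ ⊤) ∧ ∀ h : SupIrred p ∧ p < m, φ.r (.lo ⟨p, h⟩) (.hi ⟨p, h⟩)

theorem frameCol_self {m : D} {φ : LatticeCon (Frame (IrredBelow m))} :
    FrameCol m φ m ↔ φ.r ⊥ ⊤ :=
  ⟨fun h => h.1 rfl, fun h => ⟨fun _ => h, fun h' => absurd h'.2 (lt_irrefl _)⟩⟩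

theorem frameCol_of_lt {m p : D} {φ : LatticeCon (Frame (IrredBelow m))} (h : SupIrred p ∧ p < m) :
    FrameCol m φ p ↔ φ.r (.lo ⟨p, h⟩) (.hi ⟨p, h⟩) :=
  ⟨fun h' => h'.2 h, fun h' => ⟨fun he => absurd he h.2.ne, fun _ => h'⟩⟩

theorem FrameCol.mono {m p q : D} {φ : LatticeCon (Frame (IrredBelow m))} (hp : SupIrred p)
    (hpm : p ≤ m) (hqp : q ≤ p) (h : FrameCol m φ p) : FrameCol m φ q := by
  rcases hpm.eq_or_lt with rfl | hlt
  · exact ⟨fun _ => frameCol_self.1 h, fun _ => Frame.r_of_bot_top φ (frameCol_self.1 h) _ _⟩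
  · exact ⟨fun he => absurd (he ▸ hqp) hlt.not_ge,
      fun hq => Frame.lo_hi_mono φ (p := ⟨p, hp, hlt⟩) (q := ⟨q, hq⟩) hqp (h.2 ⟨hp, hlt⟩)⟩

theorem exists_pair_frameCol {m p : D} (hp : SupIrred p) (hpm : p ≤ m) :
    ∃ X Y : Frame (IrredBelow m), ∀ φ, φ.r X Y ↔ FrameCol m φ p := by
  rcases hpm.eq_or_lt with rfl | hlt
  · exact ⟨⊥, ⊤, fun φ => frameCol_self.symm⟩
  · exact ⟨.lo ⟨p, hp, hlt⟩, .hi ⟨p, hp, hlt⟩, fun φ => (frameCol_of_lt _).symm⟩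

theorem exists_frameCol_of_lt [Finite D] {m : D} (hm : SupIrred m) {X Y : Frame (IrredBelow m)}
    (hXY : X < Y) : ∃ p, SupIrred p ∧ p ≤ m ∧ (∀ φ, φ.r X Y ↔ FrameCol m φ p) ∧
      (p = m ∨ ∃ h : SupIrred p ∧ p < m, .inl ⟨p, h⟩ ∈ X.supp) := by
  by_cases h : X.supp = Y.supp
  · obtain ⟨⟨p, hp⟩, hpX, hφ⟩ := Frame.exists_colour hXY h
    exact ⟨p, hp.1, hp.2.le, fun φ => (hφ φ).trans (frameCol_of_lt hp).symm, .inr ⟨hp, hpX⟩⟩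
  · exact ⟨m, hm, le_rfl, fun φ => (Frame.r_iff_of_supp_ne φ hXY.le h).trans frameCol_self.symm,
      .inl rfl⟩

/-- The congruence of the frame lattice that collapses exactly the colours below `d`. -/
def frameCon (m d : D) : LatticeCon (Frame (IrredBelow m)) :=
  Frame.con (m ≤ d) {p | p.1 ≤ d} fun _ _ h h' => le_trans h h'

theorem frameCol_frameCon {m d p : D} (hp : SupIrred p) (hpm : p ≤ m) :
    FrameCol m (frameCon m d) p ↔ p ≤ d := by
  rcases hpm.eq_or_lt with rfl | hlt
  · exact frameCol_self.trans Frame.con_bot_top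
  · rw [frameCol_of_lt ⟨hp, hlt⟩]
    exact Frame.con_lo_hi.trans ⟨fun h => h.elim hpm.trans id, .inr⟩

theorem hi_le_of_frameCon {m d : D} {p : IrredBelow m} (hp : ¬ p.1 ≤ d) {X Y : Frame (IrredBelow m)}
    (h : (frameCon m d).r X Y) (hX : .hi p ≤ X) : .hi p ≤ Y := by
  rcases h with h | ⟨-, h⟩
  · exact absurd (p.2.2.le.trans h) hp
  · rw [Frame.hi_le_iff] at hX ⊢
    exact (h p hp).1 hX

theorem le_lo_of_frameCon {m d : D} {p : IrredBelow m} (hp : ¬ p.1 ≤ d) {X Y : Frame (IrredBelow m)}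
    (h : (frameCon m d).r X Y) (hX : X ≤ .lo p) : Y ≤ .lo p := by
  rcases h with h | ⟨hs, h⟩
  · exact absurd (p.2.2.le.trans h) hp
  · refine ⟨hs ▸ hX.1, fun q hq => ?_⟩
    obtain rfl : q = p := Sum.inl_injective (hX.1 (hs ▸ Y.full_sub q hq))
    exact hX.2 ((h q hp).2 hq)

/-! ### At most one dual atom -/

theorem hasMinimalRepresentation_of_subsingleton [BoundedOrder D] [Finite D] [Subsingleton D] :
    HasMinimalRepresentation D := by
  have hirr : ∀ p : D, ¬ SupIrred p := fun p hp => hp.1 fun b _ => (Subsingleton.elim p b).le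
  refine ⟨PUnit, inferInstance, inferInstance, inferInstance, isMinimalRepresentation_of_colouring
    (fun _ => ⊤) (fun _ _ => True) (fun p hp => absurd hp (hirr p)) (fun _ p hp => absurd hp (hirr p))
    (fun _ _ _ _ _ _ _ => trivial) fun x y h => absurd (Subsingleton.elim x y) h.ne⟩

theorem hasMinimalRepresentation_of_supIrred_top [BoundedOrder D] [Finite D]
    (htop : SupIrred (⊤ : D)) : HasMinimalRepresentation D := by
  refine ⟨Frame (IrredBelow (⊤ : D)), inferInstance, inferInstance, ⟨⊥⟩,
    isMinimalRepresentation_of_colouring (frameCon ⊤) (FrameCol ⊤) (fun p hp => ?_)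
    (fun d p hp => frameCol_frameCon hp le_top) (fun φ p q hp _ hqp h => h.mono hp le_top hqp)
    fun X Y h => ?_⟩
  · obtain ⟨X, Y, h⟩ := exists_pair_frameCol hp le_top
    exact ⟨X, Y, h⟩
  · obtain ⟨p, hp, -, h, -⟩ := exists_frameCol_of_lt htop h
    exact .inl ⟨p, hp, h⟩

/-! ### Two dual atoms -/

variable {m₁ m₂ : D}

/-- The join-irreducible elements strictly below both `m₁` and `m₂`, included in those below `m₁`. -/
def commonLeft (m₁ m₂ : D) : {p : D // SupIrred p ∧ p < m₁ ∧ p < m₂} ↪ IrredBelow m₁ where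
  toFun c := ⟨c.1, c.2.1, c.2.2.1⟩
  inj' _ _ h := Subtype.ext (congrArg (fun x => x.1) h)

/-- The join-irreducible elements strictly below both `m₁` and `m₂`, included in those below `m₂`. -/
def commonRight (m₁ m₂ : D) : {p : D // SupIrred p ∧ p < m₁ ∧ p < m₂} ↪ IrredBelow m₂ where
  toFun c := ⟨c.1, c.2.1, c.2.2.2⟩
  inj' _ _ h := Subtype.ext (congrArg (fun x => x.1) h)

/-- The lattice that represents `D` when the unit of `D` is the join of the join-irreducible elements
`m₁` and `m₂`: two frame lattices glued together, with the common colours identified by inserted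
elements. -/
abbrev DoubleFrame (m₁ m₂ : D) : Type u :=
  Inserted (glue.squares (commonLeft m₁ m₂) (commonRight m₁ m₂))

/-- The restriction of a congruence to the lower frame lattice. -/
noncomputable def lowerCon (φ : LatticeCon (DoubleFrame m₁ m₂)) : LatticeCon (Frame (IrredBelow m₁)) :=
  glue.lower (φ.comap (Inserted.incl _))

/-- The restriction of a congruence to the upper frame lattice. -/
noncomputable def upperCon (φ : LatticeCon (DoubleFrame m₁ m₂)) : LatticeCon (Frame (IrredBelow m₂)) :=
  glue.upper (φ.comap (Inserted.incl _))

/-- The congruence `φ` collapses the colour `p` in each of the two frame lattices in which that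
colour occurs. -/
def DoubleCol (φ : LatticeCon (DoubleFrame m₁ m₂)) (p : D) : Prop :=
  (p ≤ m₁ → FrameCol m₁ (lowerCon φ) p) ∧ (p ≤ m₂ → FrameCol m₂ (upperCon φ) p)

theorem DoubleCol.mono {φ : LatticeCon (DoubleFrame m₁ m₂)} {p q : D} (h₁₂ : ¬ m₁ ≤ m₂)
    (h₂₁ : ¬ m₂ ≤ m₁) (hm : ∀ p, SupIrred p → p ≤ m₁ ∨ p ≤ m₂) (hp : SupIrred p) (hq : SupIrred q)
    (hqp : q ≤ p) (h : DoubleCol φ p) : DoubleCol φ q := by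
  have link : q < m₁ → q < m₂ →
      (FrameCol m₁ (lowerCon φ) q ↔ FrameCol m₂ (upperCon φ) q) := fun h₁ h₂ => by
    rw [frameCol_of_lt ⟨hq, h₁⟩, frameCol_of_lt ⟨hq, h₂⟩]
    exact glue.lower_lo_hi_iff φ ⟨q, hq, h₁, h₂⟩
  have lt₁ : q ≤ m₁ → q ≤ m₂ → q < m₁ := fun h₁ h₂ =>
    h₁.lt_of_ne (by rintro rfl; exact h₁₂ h₂)
  have lt₂ : q ≤ m₁ → q ≤ m₂ → q < m₂ := fun h₁ h₂ =>
    h₂.lt_of_ne (by rintro rfl; exact h₂₁ h₁)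
  rcases hm p hp with hpm | hpm
  · have hc := (h.1 hpm).mono hp hpm hqp
    exact ⟨fun _ => hc, fun h₂ => (link (lt₁ (hqp.trans hpm) h₂) (lt₂ (hqp.trans hpm) h₂)).1 hc⟩
  · have hc := (h.2 hpm).mono hp hpm hqp
    exact ⟨fun h₁ => (link (lt₁ h₁ (hqp.trans hpm)) (lt₂ h₁ (hqp.trans hpm))).2 hc, fun _ => hc⟩

theorem doubleCol_iff_lower {φ : LatticeCon (DoubleFrame m₁ m₂)} {p : D} (h₁₂ : ¬ m₁ ≤ m₂)
    (h₂₁ : ¬ m₂ ≤ m₁) (hp : SupIrred p) (hpm : p ≤ m₁) :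
    DoubleCol φ p ↔ FrameCol m₁ (lowerCon φ) p := by
  refine ⟨fun h => h.1 hpm, fun h => ⟨fun _ => h, fun h₂ => ?_⟩⟩
  have hp₁ : p < m₁ := hpm.lt_of_ne (by rintro rfl; exact h₁₂ h₂)
  have hp₂ : p < m₂ := h₂.lt_of_ne (by rintro rfl; exact h₂₁ hpm)
  rw [frameCol_of_lt ⟨hp, hp₁⟩] at h
  rw [frameCol_of_lt ⟨hp, hp₂⟩]
  exact (glue.lower_lo_hi_iff φ ⟨p, hp, hp₁, hp₂⟩).1 h

theorem doubleCol_iff_upper {φ : LatticeCon (DoubleFrame m₁ m₂)} {p : D} (h₁₂ : ¬ m₁ ≤ m₂)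
    (h₂₁ : ¬ m₂ ≤ m₁) (hp : SupIrred p) (hpm : p ≤ m₂) :
    DoubleCol φ p ↔ FrameCol m₂ (upperCon φ) p := by
  refine ⟨fun h => h.2 hpm, fun h => ⟨fun h₁ => ?_, fun _ => h⟩⟩
  have hp₁ : p < m₁ := h₁.lt_of_ne (by rintro rfl; exact h₁₂ hpm)
  have hp₂ : p < m₂ := hpm.lt_of_ne (by rintro rfl; exact h₂₁ h₁)
  rw [frameCol_of_lt ⟨hp, hp₂⟩] at h
  rw [frameCol_of_lt ⟨hp, hp₁⟩]
  exact (glue.lower_lo_hi_iff φ ⟨p, hp, hp₁, hp₂⟩).2 h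

/-- The congruence of the double frame lattice that collapses exactly the colours below `d`. -/
noncomputable def doubleCon (m₁ m₂ d : D) : LatticeCon (DoubleFrame m₁ m₂) :=
  Inserted.extend (glue.con (frameCon m₁ d) (frameCon m₂ d)) {c | c.1 ≤ d}
    (fun c hc => by
      have h₁ : (frameCon m₁ d).r (.lo (commonLeft m₁ m₂ c)) (.hi (commonLeft m₁ m₂ c)) :=
        Frame.con_lo_hi.2 (.inr hc)
      have h₂ : (frameCon m₂ d).r (.lo (commonRight m₁ m₂ c)) (.hi (commonRight m₁ m₂ c)) :=
        Frame.con_lo_hi.2 (.inr hc)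
      rw [glue.con_r]
      simp only [glue.squares, glue.fst_inf, glue.fst_sup, glue.snd_inf, glue.snd_sup, glue.fst_mk,
        glue.snd_mk, sup_eq_right.2 (Frame.lo_le_hi _), inf_eq_left.2 (Frame.lo_le_hi _)]
      exact ⟨(frameCon m₁ d).iseqv.symm h₁, h₂⟩)
    (fun c hc s t h hs => by
      rw [glue.bot_le_iff] at hs ⊢
      exact ⟨hi_le_of_frameCon hc h.1 hs.1, le_lo_of_frameCon hc h.2 hs.2⟩)
    (fun c hc s t h hs => by
      rw [glue.le_top_iff] at hs ⊢
      exact ⟨le_lo_of_frameCon hc h.1 hs.1, hi_le_of_frameCon hc h.2 hs.2⟩)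

theorem lowerCon_doubleCon (d : D) : lowerCon (doubleCon m₁ m₂ d) = frameCon m₁ d :=
  by
  refine LatticeCon.ext_rel fun x y => ?_
  change (doubleCon m₁ m₂ d).r (Inserted.old _ _) (Inserted.old _ _) ↔ _
  rw [doubleCon, Inserted.extend_r_old, glue.con_r]
  exact and_iff_left (LatticeCon.r_self _ _)

theorem upperCon_doubleCon (d : D) : upperCon (doubleCon m₁ m₂ d) = frameCon m₂ d :=
  by
  refine LatticeCon.ext_rel fun x y => ?_
  change (doubleCon m₁ m₂ d).r (Inserted.old _ _) (Inserted.old _ _) ↔ _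
  rw [doubleCon, Inserted.extend_r_old, glue.con_r]
  exact and_iff_right (LatticeCon.r_self _ _)

/-- An interval between elements of the glued lattice has a colour or generates the unit congruence.
In a pair that moves both components, the component with a colour below `m₁` or `m₂` lies in the
square of a common colour, so this colour is absorbed by that of the other component. -/
theorem exists_doubleCol_of_old_lt [Finite D] (h₁₂ : ¬ m₁ ≤ m₂) (h₂₁ : ¬ m₂ ≤ m₁)
    (hm : ∀ p, SupIrred p → p ≤ m₁ ∨ p ≤ m₂) (hm₁ : SupIrred m₁) (hm₂ : SupIrred m₂)
    {s t : glue (commonLeft m₁ m₂) (commonRight m₁ m₂)} (hst : s < t) :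
    (∃ p, SupIrred p ∧ ∀ φ : LatticeCon (DoubleFrame m₁ m₂),
      φ.r (Inserted.old _ s) (Inserted.old _ t) ↔ DoubleCol φ p) ∨
    ∀ φ : LatticeCon (DoubleFrame m₁ m₂),
      φ.r (Inserted.old _ s) (Inserted.old _ t) ↔ ∀ p, SupIrred p → DoubleCol φ p := by
  have hr : ∀ φ : LatticeCon (DoubleFrame m₁ m₂), φ.r (Inserted.old _ s) (Inserted.old _ t) ↔
      (lowerCon φ).r (glue.fst t) (glue.fst s) ∧ (upperCon φ).r (glue.snd s) (glue.snd t) :=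
    fun φ => glue.r_iff (φ.comap (Inserted.incl _)) hst.le
  simp only [hr]
  obtain ⟨hx, hy⟩ := glue.le_iff.1 hst.le
  rcases hx.eq_or_lt with hx | hx
  · rcases hy.eq_or_lt with hy | hy
    · exact absurd (glue.ext hx.symm hy) hst.ne
    · obtain ⟨p, hp, hpm, hφ, -⟩ := exists_frameCol_of_lt hm₂ hy
      refine .inl ⟨p, hp, fun φ => ?_⟩
      rw [hφ, hx, doubleCol_iff_upper h₁₂ h₂₁ hp hpm]
      exact and_iff_right (LatticeCon.r_self _ _)
  · obtain ⟨p, hp, hpm, hφ, hps⟩ := exists_frameCol_of_lt hm₁ hx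
    rcases hy.eq_or_lt with hy | hy
    · refine .inl ⟨p, hp, fun φ => ?_⟩
      rw [hφ, hy, doubleCol_iff_lower h₁₂ h₂₁ hp hpm]
      exact and_iff_left (LatticeCon.r_self _ _)
    · obtain ⟨q, hq, hqm, hψ, hqs⟩ := exists_frameCol_of_lt hm₂ hy
      have hiff : ∀ φ : LatticeCon (DoubleFrame m₁ m₂),
          ((lowerCon φ).r (glue.fst t) (glue.fst s) ∧ (upperCon φ).r (glue.snd s) (glue.snd t)) ↔
            DoubleCol φ p ∧ DoubleCol φ q := fun φ => by
        rw [hφ, hψ, doubleCol_iff_lower h₁₂ h₂₁ hp hpm, doubleCol_iff_upper h₁₂ h₂₁ hq hqm]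
      simp only [hiff]
      have absorb : ∀ {p q : D}, SupIrred p → SupIrred q → q ≤ p →
          ∀ φ : LatticeCon (DoubleFrame m₁ m₂), DoubleCol φ p → DoubleCol φ q :=
        fun hp hq hqp φ h => h.mono h₁₂ h₂₁ hm hp hq hqp
      -- a colour other than `m₁` in the lower component bounds the upper component of `t`
      have hleft : p ≠ m₁ → p ≤ m₂ ∧ ∀ q' h, .inl ⟨q', h⟩ ∈ (glue.snd s).supp → q' = p := by
        intro hne
        obtain ⟨h, hpt⟩ := hps.resolve_left hne
        rcases glue.mem t with h' | h' | ⟨c, h', h''⟩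
        · exact absurd (h' ▸ hy) not_lt_bot
        · rw [h'] at hpt
          exact hpt.elim
        · have hc := Sum.inl_injective (h'.1 hpt)
          have hc : p = c.1 := congrArg Subtype.val hc
          refine ⟨hc ▸ c.2.2.2.le, fun q' hq' hmem => ?_⟩
          have hc' := Sum.inl_injective (h''.1 (hy.le.1 hmem))
          have hc' : q' = c.1 := congrArg Subtype.val hc'
          rw [hc, hc']
      have hright : q ≠ m₂ → q ≤ m₁ := by
        intro hne
        obtain ⟨h, hqs⟩ := hqs.resolve_left hne
        rcases glue.mem s with h' | h' | ⟨c, h', h''⟩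
        · rw [h'] at hqs
          exact hqs.elim
        · exact absurd (h' ▸ hx) not_lt_bot
        · have hc := Sum.inl_injective (h''.1 hqs)
          have hc : q = c.1 := congrArg Subtype.val hc
          exact hc ▸ c.2.2.1.le
      by_cases hp₁ : p = m₁
      · subst hp₁
        by_cases hq₂ : q = m₂
        · subst hq₂
          refine .inr fun φ => ⟨fun h p' hp' => ?_, fun h => ⟨h _ hp, h _ hq⟩⟩
          rcases hm p' hp' with h' | h'
          · exact absorb hp hp' h' φ h.1
          · exact absorb hq hp' h' φ h.2
        · exact .inl ⟨p, hp, fun φ => and_iff_left_of_imp (absorb hp hq (hright hq₂) φ)⟩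
      · by_cases hq₂ : q = m₂
        · subst hq₂
          exact .inl ⟨q, hq, fun φ => and_iff_right_of_imp (absorb hq hp (hleft hp₁).1 φ)⟩
        · obtain ⟨h, hmem⟩ := hqs.resolve_left hq₂
          obtain rfl := (hleft hp₁).2 q h hmem
          exact .inl ⟨q, hq, fun φ => and_self_iff⟩

theorem hasMinimalRepresentation_of_two [BoundedOrder D] [Finite D] (h₁₂ : ¬ m₁ ≤ m₂)
    (h₂₁ : ¬ m₂ ≤ m₁) (hm : ∀ p, SupIrred p → p ≤ m₁ ∨ p ≤ m₂) (hm₁ : SupIrred m₁)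
    (hm₂ : SupIrred m₂) : HasMinimalRepresentation D := by
  refine ⟨DoubleFrame m₁ m₂, inferInstance, inferInstance, ⟨⊥⟩,
    isMinimalRepresentation_of_colouring (doubleCon m₁ m₂) DoubleCol (fun p hp => ?_)
    (fun d p hp => ?_) (fun φ p q hp hq hqp h => h.mono h₁₂ h₂₁ hm hp hq hqp) fun x y hxy => ?_⟩
  · rcases hm p hp with hpm | hpm
    · obtain ⟨X, Y, h⟩ := exists_pair_frameCol hp hpm
      exact ⟨_, _, fun φ => (h (lowerCon φ)).trans (doubleCol_iff_lower h₁₂ h₂₁ hp hpm).symm⟩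
    · obtain ⟨X, Y, h⟩ := exists_pair_frameCol hp hpm
      exact ⟨_, _, fun φ => (h (upperCon φ)).trans (doubleCol_iff_upper h₁₂ h₂₁ hp hpm).symm⟩
  · rcases hm p hp with hpm | hpm
    · rw [doubleCol_iff_lower h₁₂ h₂₁ hp hpm, lowerCon_doubleCon, frameCol_frameCon hp hpm]
    · rw [doubleCol_iff_upper h₁₂ h₂₁ hp hpm, upperCon_doubleCon, frameCol_frameCon hp hpm]
  · have old : ∀ {s t}, s < t → _ := fun {s t} =>
      exists_doubleCol_of_old_lt h₁₂ h₂₁ hm hm₁ hm₂ (s := s) (t := t)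
    have hsq : ∀ c, (glue.squares (commonLeft m₁ m₂) (commonRight m₁ m₂)).r c ⊓
        (glue.squares (commonLeft m₁ m₂) (commonRight m₁ m₂)).s c <
        (glue.squares (commonLeft m₁ m₂) (commonRight m₁ m₂)).r c ⊔
        (glue.squares (commonLeft m₁ m₂) (commonRight m₁ m₂)).s c := fun c =>
      lt_of_le_not_ge inf_le_sup (SquareFamily.sep _ c c)
    induction x using Inserted.ind with
    | old s =>
      induction y using Inserted.ind with
      | old t => exact old ⟨hxy.le, hxy.not_ge⟩
      | new c =>
        have h := Inserted.old_le_new.1 hxy.le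
        simp only [Inserted.r_old_new_iff _ c h]
        exact old (h.trans_lt (hsq c))
    | new c =>
      induction y using Inserted.ind with
      | old t =>
        have h := Inserted.new_le_old.1 hxy.le
        simp only [Inserted.r_new_old_iff _ c h]
        exact old ((hsq c).trans_le h)
      | new c' => exact absurd (congrArg (Inserted.new _) (Inserted.new_le_new.1 hxy.le)) hxy.ne

end Colours

/-! ### Dual atoms and maximal join-irreducible elements -/

section Coatoms

variable {D : Type u} [DistribLattice D] [BoundedOrder D] [Finite D]

theorem IsCoatom.exists_supIrred_not_le {c : D} (hc : IsCoatom c) : ∃ m, SupIrred m ∧ ¬ m ≤ c := by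
  by_contra! h
  exact hc.1 (top_le_iff.1 (le_iff_forall_supIrred_le.2 fun p hp _ => h p hp))

theorem hasMinimalRepresentation_of_ncard (h : {a : D | IsCoatom a}.ncard ≤ 2) :
    HasMinimalRepresentation D := by
  rcases subsingleton_or_nontrivial D with hD | hD
  · exact hasMinimalRepresentation_of_subsingleton
  obtain ⟨c₁, h₁, -⟩ := (eq_top_or_exists_le_coatom (⊥ : D)).resolve_left bot_ne_top
  obtain ⟨m₁, hm₁, hmc₁⟩ := h₁.exists_supIrred_not_le
  by_cases hone : ∀ c : D, IsCoatom c → c = c₁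
  · have htop : m₁ = ⊤ := by
      by_contra hne
      obtain ⟨c, hc, hle⟩ := (eq_top_or_exists_le_coatom m₁).resolve_left hne
      exact hmc₁ (hone c hc ▸ hle)
    exact hasMinimalRepresentation_of_supIrred_top (htop ▸ hm₁)
  push Not at hone
  obtain ⟨c₂, h₂, hne⟩ := hone
  obtain ⟨m₂, hm₂, hmc₂⟩ := h₂.exists_supIrred_not_le
  have hall : ∀ c : D, IsCoatom c → c = c₁ ∨ c = c₂ := by
    intro c hc
    by_contra! hcon
    refine h.not_gt ((Set.two_lt_ncard_iff (Set.toFinite _)).2 ⟨c, c₁, c₂, hc, h₁, h₂, ?_⟩)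
    exact ⟨hcon.1, hcon.2, hne.symm⟩
  -- a join-irreducible element fails to lie below at most one dual atom
  have hle₁ : m₁ ≤ c₂ := by
    by_contra hcon
    exact hne (h₁.eq_of_not_le_of_supIrred h₂ hm₁ hmc₁ hcon).symm
  have hle₂ : m₂ ≤ c₁ := by
    by_contra hcon
    exact hne (h₁.eq_of_not_le_of_supIrred h₂ hm₂ hcon hmc₂).symm
  have hsup : m₁ ⊔ m₂ = ⊤ := by
    by_contra hcon
    obtain ⟨c, hc, hle⟩ := (eq_top_or_exists_le_coatom _).resolve_left hcon
    rcases hall c hc with rfl | rfl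
    · exact hmc₁ (le_sup_left.trans hle)
    · exact hmc₂ (le_sup_right.trans hle)
  exact hasMinimalRepresentation_of_two (fun h => hmc₁ (h.trans hle₂)) (fun h => hmc₂ (h.trans hle₁))
    (fun p hp => (supPrime_iff_supIrred.2 hp).le_sup.1 (hsup ▸ le_top)) hm₁ hm₂

end Coatoms

theorem theorem1 (D : Type u) [DistribLattice D] [BoundedOrder D] [Finite D] :
    HasMinimalRepresentation D ↔ {a : D | IsCoatom a}.ncard ≤ 2 := by
  refine ⟨?_, hasMinimalRepresentation_of_ncard⟩
  rintro ⟨L, _, _, _, h⟩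
  exact ncard_coatoms_le_two h
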